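/- All functions are complex-valued unless said otherwise, all spaces are regarded as real spaces, and functions $f$ are identified with functionals through $\langle f,v\rangle=\mathrm{Re}\int f\,\overline v\,dx$. Let $\mathbb A=\mathbb C\setminus\{z:\mathrm{Re}(z)\le 0,\ \mathrm{Im}(z)=0\}$ and call $(a,b)\in\mathbb C^2$ *admissible* if $(a,b)\in\mathbb A\times\mathbb A$ and either $\mathrm{Im}(a)\,\mathrm{Im}(b)\ge 0$, or $\mathrm{Im}(a)\,\mathrm{Im}(b)<0$ and $\mathrm{Re}(b)>\frac{\mathrm{Im}(b)}{\mathrm{Im}(a)}\mathrm{Re}(a)$. Let $N\ge 1$, and let $\phi:\mathbb R^N\to\mathbb R$ satisfy $\phi\ge 0$ a.e. and $\phi\in L^\infty(\mathbb R^N)+L^{p}(\mathbb R^N)$, where $p=2$ if $N=1$, $p\in(2,\infty)$ if $N=2$, and $p=N$ if $N\ge 3$. Let $F\in H^{-1}(\mathbb R^N)=H^1(\mathbb R^N)^\star$. A function $u\in H^1(\mathbb R^N)\cap L^1(\mathbb R^N)$ is a *global weak solution* of $$-\Delta u+a\,U+b\,u+\phi\,u=F\quad\text{in }\mathbb R^N$$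 if there is $U\in L^\infty(\mathbb R^N)$ with $\|U\|_{L^\infty}\le 1$ and $U=u/|u|$ a.e. on $\{u\ne 0\}$ such that, for every $v\in H^1(\mathbb R^N)\cap L^1(\mathbb R^N)$, $$\mathrm{Re}\int\nabla u\cdot\overline{\nabla v}\,dx+\mathrm{Re}\int a\,U\,\overline v\,dx+\mathrm{Re}\int b\,u\,\overline v\,dx+\mathrm{Re}\int\phi\,u\,\overline v\,dx=\langle F,v\rangle .$$ **Theorem 5.1.** There is a constant $M=M(a,b)>0$, depending only and continuously on the admissible pair $(a,b)$ (in particular not on $N,\phi,F,u,U,K$), with the following property. Let $(a,b)$ be admissible, let $N$, $\phi$ and $F$ be as above, and let $u$ be any global weak solution of the equation. If there is a compact set $K\subset\mathbb R^N$ such that the restriction of the distribution $F$ to $K^{\mathrm c}$ belongs to $L^\infty(K^{\mathrm c})$ and $\|F\|_{L^\infty(K^{\mathrm c})}\le\frac1M$, then $\operatorname{supp}u$ is compact. ($F$ is not assumed to vanish anywhere.) -/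

import Mathlib

open MeasureTheory Set
open scoped ContDiff ENNReal ComplexConjugate

noncomputable section

namespace SaturatedSchrodinger

/-- The Euclidean space `ℝ^N`. -/
abbrev Space (N : ℕ) : Type := EuclideanSpace ℝ (Fin N)

/-- The space `L²(ℝ^N; ℂ)`. -/
abbrev L2 (N : ℕ) : Type := Lp ℂ 2 (volume : Measure (Space N))

/-- The space `L²(ℝ^N; ℂ^N)` of square integrable complex vector fields. -/
abbrev L2Vec (N : ℕ) : Type :=
  Lp (EuclideanSpace ℂ (Fin N)) 2 (volume : Measure (Space N))

/-- `g` is the weak (distributional) gradient of `u`: for every real test function `ψ` and every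
direction `j`, `∫ (∂_j ψ) u = - ∫ ψ g_j`. -/
def HasWeakGradient {N : ℕ} (u : Space N → ℂ) (g : Space N → EuclideanSpace ℂ (Fin N)) : Prop :=
  ∀ ψ : Space N → ℝ, ContDiff ℝ ∞ ψ → HasCompactSupport ψ → ∀ j : Fin N,
    ∫ x, (fderiv ℝ ψ x (EuclideanSpace.single j 1)) • u x = - ∫ x, ψ x • g x j

/-- A bounded compactly supported continuous function times an `L²` function is integrable. -/
theorem integrable_smul_of_memLp {N : ℕ} {η : Space N → ℝ} (hη : Continuous η)
    (hc : HasCompactSupport η) {w : Space N → ℂ} (hw : MemLp w 2 volume) :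
    Integrable (fun x => η x • w x) volume := by
  have h : MemLp η 2 (volume : Measure (Space N)) := hη.memLp_of_hasCompactSupport hc
  exact memLp_one_iff_integrable.1 (hw.smul h)

/-- The partial derivative of a test function is continuous with compact support. -/
theorem continuous_partial {N : ℕ} {ψ : Space N → ℝ} (hψ : ContDiff ℝ ∞ ψ)
    (hc : HasCompactSupport ψ) (e : Space N) :
    Continuous (fun x => fderiv ℝ ψ x e) ∧ HasCompactSupport (fun x => fderiv ℝ ψ x e) :=
  ⟨(hψ.continuous_fderiv (by simp)).clm_apply continuous_const, hc.fderiv_apply ℝ e⟩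

/-- The components of a square integrable vector field are square integrable. -/
theorem memLp_component {N : ℕ} (g : L2Vec N) (j : Fin N) :
    MemLp (fun x => g x j) 2 (volume : Measure (Space N)) :=
  (EuclideanSpace.proj (𝕜 := ℂ) j : EuclideanSpace ℂ (Fin N) →L[ℂ] ℂ).comp_memLp' (Lp.memLp g)

/-- The Sobolev space `H¹(ℝ^N) = H¹₀(ℝ^N)` of complex-valued functions, as a real normed space:
the pairs `(u, ∇u)` in `L² × L²`, with the norm `(‖u‖² + ‖∇u‖²)^{1/2}`. -/
def H1 (N : ℕ) : Submodule ℝ (WithLp 2 (L2 N × L2Vec N)) where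
  carrier := {p | HasWeakGradient (p.fst : Space N → ℂ) (p.snd : Space N → EuclideanSpace ℂ (Fin N))}
  add_mem' := by
    intro p q hp hq ψ hψ hc j
    obtain ⟨h1, h2⟩ := continuous_partial hψ hc (EuclideanSpace.single j 1)
    have e1 : ∫ x, (fderiv ℝ ψ x (EuclideanSpace.single j 1)) • (p + q).fst x
        = ∫ x, ((fderiv ℝ ψ x (EuclideanSpace.single j 1)) • p.fst x
          + (fderiv ℝ ψ x (EuclideanSpace.single j 1)) • q.fst x) := by
      refine integral_congr_ae ?_
      filter_upwards [Lp.coeFn_add p.fst q.fst] with x hx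
      rw [WithLp.add_fst, hx, Pi.add_apply, smul_add]
    have e2 : ∫ x, ψ x • (p + q).snd x j
        = ∫ x, (ψ x • p.snd x j + ψ x • q.snd x j) := by
      refine integral_congr_ae ?_
      filter_upwards [Lp.coeFn_add p.snd q.snd] with x hx
      rw [WithLp.add_snd, hx, Pi.add_apply, PiLp.add_apply, smul_add]
    rw [e1, e2, integral_add (integrable_smul_of_memLp h1 h2 (Lp.memLp _))
        (integrable_smul_of_memLp h1 h2 (Lp.memLp _)),
      integral_add (integrable_smul_of_memLp hψ.continuous hc (memLp_component _ j))
        (integrable_smul_of_memLp hψ.continuous hc (memLp_component _ j)),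
      hp ψ hψ hc j, hq ψ hψ hc j, neg_add]
  zero_mem' := by
    intro ψ hψ hc j
    have e1 : ∫ x, (fderiv ℝ ψ x (EuclideanSpace.single j 1)) •
        (0 : WithLp 2 (L2 N × L2Vec N)).fst x = ∫ _ : Space N, (0 : ℂ) := by
      refine integral_congr_ae ?_
      filter_upwards [Lp.coeFn_zero ℂ 2 (volume : Measure (Space N))] with x hx
      rw [WithLp.zero_fst, hx, Pi.zero_apply, smul_zero]
    have e2 : ∫ x, ψ x • (0 : WithLp 2 (L2 N × L2Vec N)).snd x j = ∫ _ : Space N, (0 : ℂ) := by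
      refine integral_congr_ae ?_
      filter_upwards [Lp.coeFn_zero (EuclideanSpace ℂ (Fin N)) 2
        (volume : Measure (Space N))] with x hx
      rw [WithLp.zero_snd, hx, Pi.zero_apply, PiLp.zero_apply, smul_zero]
    rw [e1, e2]
    simp
  smul_mem' := by
    intro c p hp ψ hψ hc j
    have e1 : ∫ x, (fderiv ℝ ψ x (EuclideanSpace.single j 1)) • (c • p).fst x
        = ∫ x, c • ((fderiv ℝ ψ x (EuclideanSpace.single j 1)) • p.fst x) := by
      refine integral_congr_ae ?_
      filter_upwards [Lp.coeFn_smul c p.fst] with x hx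
      rw [WithLp.smul_fst, hx, Pi.smul_apply, smul_comm]
    have e2 : ∫ x, ψ x • (c • p).snd x j = ∫ x, c • (ψ x • p.snd x j) := by
      refine integral_congr_ae ?_
      filter_upwards [Lp.coeFn_smul c p.snd] with x hx
      rw [WithLp.smul_snd, hx, Pi.smul_apply, PiLp.smul_apply, smul_comm]
    rw [e1, e2, integral_smul, integral_smul, hp ψ hψ hc j, smul_neg]

/-- The function underlying an element of `H¹(ℝ^N)`. -/
def funOf {N : ℕ} (u : H1 N) : Space N → ℂ := u.1.fst

/-- The weak gradient of an element of `H¹(ℝ^N)`. -/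
def gradOf {N : ℕ} (u : H1 N) : Space N → EuclideanSpace ℂ (Fin N) := u.1.snd

/-- The space `H⁻¹(ℝ^N)`: the topological dual of `H¹₀(ℝ^N) = H¹(ℝ^N)`, regarded as a real
Banach space. -/
abbrev HNegOne (N : ℕ) : Type := H1 N →L[ℝ] ℝ

/-- The admissible pairs of coefficients; `Complex.slitPlane` is the complex plane without the
closed negative real half-line `{Re z ≤ 0, Im z = 0}`. -/
def Admissible (a b : ℂ) : Prop :=
  a ∈ Complex.slitPlane ∧ b ∈ Complex.slitPlane ∧
    (0 ≤ a.im * b.im ∨ (a.im * b.im < 0 ∧ b.im / a.im * a.re < b.re))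

/-- `p` is an exponent allowed for the unbounded part of the potential in dimension `N`:
`2` if `N = 1`, any finite number larger than `2` if `N = 2`, and `N` if `N ≥ 3`. -/
def IsPotentialExponent (N : ℕ) (p : ℝ≥0∞) : Prop :=
  (N = 1 ∧ p = 2) ∨ (N = 2 ∧ 2 < p ∧ p < ⊤) ∨ (3 ≤ N ∧ p = N)

/-- The admissible potentials: nonnegative (almost everywhere) real functions in
`L^∞(ℝ^N) + L^p(ℝ^N)`, with `p` an allowed exponent. -/
def IsPotential {N : ℕ} (φ : Space N → ℝ) : Prop :=
  (∀ᵐ x, 0 ≤ φ x) ∧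
    ∃ p, IsPotentialExponent N p ∧
      ∃ φ₁ φ₂ : Space N → ℝ, MemLp φ₁ ⊤ volume ∧ MemLp φ₂ p volume ∧
        ∀ᵐ x, φ x = φ₁ x + φ₂ x

/-- `U` is a saturated section associated to `u`: `U ∈ L^∞`, `‖U‖_{L^∞} ≤ 1`, and `U = u / |u|`
almost everywhere on the set where `u ≠ 0`. -/
structure IsSaturatedSection {N : ℕ} (u U : Space N → ℂ) : Prop where
  memLp : MemLp U ⊤ volume
  norm_le : eLpNorm U ⊤ volume ≤ 1
  eq_sign : ∀ᵐ x, u x ≠ 0 → U x = u x / (‖u x‖ : ℂ)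

/-- `(u, U)` is a global weak solution of `-Δu + a U + b u + φ u = F` on `ℝ^N`:
`u ∈ H¹ ∩ L¹`, `U` is a saturated section of `u`, and the equation holds against all
`v ∈ H¹ ∩ L¹`, each duality product being `⟨f, v⟩ = Re ∫ f v̄`. -/
structure IsGlobalWeakSolution {N : ℕ} (a b : ℂ) (φ : Space N → ℝ) (F : HNegOne N)
    (u : H1 N) (U : Space N → ℂ) : Prop where
  integrable : Integrable (funOf u) volume
  section_of : IsSaturatedSection (funOf u) U
  equation : ∀ v : H1 N, Integrable (funOf v) volume →
    (∫ x, ∑ j, gradOf u x j * conj (gradOf v x j)).re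
      + (∫ x, a * U x * conj (funOf v x)).re
      + (∫ x, b * funOf u x * conj (funOf v x)).re
      + (∫ x, (φ x : ℂ) * funOf u x * conj (funOf v x)).re = F v

/-- On the open set `O`, the distribution `F ∈ H⁻¹(ℝ^N)` is the function `f ∈ L^∞(O)`:
`⟨F, ψ⟩ = Re ∫ f ψ̄` for every test function `ψ ∈ C_c^∞(O; ℂ)`. -/
def RestrictsTo {N : ℕ} (F : HNegOne N) (O : Set (Space N)) (f : Space N → ℂ) : Prop :=
  MemLp f ⊤ (volume.restrict O) ∧
    ∀ ψ : Space N → ℂ, ContDiff ℝ ∞ ψ → HasCompactSupport ψ → tsupport ψ ⊆ O →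
      ∀ v : H1 N, funOf v =ᵐ[volume] ψ → F v = (∫ x in O, f x * conj (ψ x)).re

/-- The support of (the almost everywhere class of) a measurable function: the complement of the
largest open set on which it vanishes almost everywhere. -/
def essSupp {N : ℕ} (u : Space N → ℂ) : Set (Space N) :=
  ((volume : Measure (Space N)).restrict {x | u x ≠ 0}).support

end SaturatedSchrodinger

end

noncomputable section

namespace SaturatedSchrodinger

open Filter Topology Metric

/-! ### Coercivity of admissible pairs -/

/-! The equation is tested with `v = (1 + iλ) η² u`, where `η` is a cutoff supported in a ball away
from `K`. Admissibility provides a real `λ` for which `α = Re a + λ Im a` and `β = Re b + λ Im b`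
are both positive (`Admissible.exists_multiplier`). Since `U ū = |u|`, the real parts of the zeroth
order terms are `α ∫ η²|u|`, `β ∫ η²|u|²` and a nonnegative potential term. If `|f| ≤ α / (2|1 +
iλ|)` off `K`, the right-hand side absorbs at most half of `α ∫ η²|u|`; this dictates `M = 2|1 + iλ|
/ α`, continuous once `λ` is chosen continuously. Absorbing the cross term of the gradient leaves a
Caccioppoli estimate (`IsGlobalWeakSolution.energy_le`): the energy `E(s) = ∫_{B_s} |∇u|² + |u| +
|u|²` is controlled by `∫ |∇η|²|u|²`.

The first power of `|u|` in `E` makes this superlinear. The Nash inequality `∫|w|² ≤ r² ∫|∇w|² + C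
r^{-N} (∫|w|)²` (`integral_sq_le`), applied to a truncation of `u`, bounds the mass by `r² E +
r^{-N} E²` with `r` free (`exists_mass_le`). Hence `E(s) ≤ C (t - s)^{-4} (r² E(t) + r^{-N} E(t)²)`,
and a De Giorgi iteration with geometrically decreasing `r` (`exists_threshold_of_recursion`) yields
`δ > 0`, the same for all centres, such that `E(2) ≤ δ` forces `E(1) = 0`. As `u ∈ H¹ ∩ L¹` has
finite total energy, every ball far enough from the origin has energy at most `δ`, so `u` vanishes
there. -/

/-- The multipliers `1 + iλ` for which both zeroth order coefficients become coercive. -/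
def coerciveMultipliers (p : ℂ × ℂ) : Set ℝ :=
  {l | 0 < p.1.re + l * p.1.im ∧ 0 < p.2.re + l * p.2.im}

/-- When the imaginary parts share a sign, `λ → ±∞` works, since a point of the slit plane has
positive real part or nonzero imaginary part. When the signs are opposite, one condition bounds `λ`
below and the other above; the extra inequality in admissibility says that this interval is
nonempty. -/
theorem Admissible.exists_multiplier {a b : ℂ} (h : Admissible a b) :
    ∃ l : ℝ, l ∈ coerciveMultipliers (a, b) := by
  obtain ⟨ha, hb, h⟩ := h
  rw [Complex.mem_slitPlane_iff] at ha hb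
  have key : ∀ z : ℂ, (0 < z.re ∨ z.im ≠ 0) → 0 ≤ z.im →
      ∀ᶠ l : ℝ in atTop, 0 < z.re + l * z.im := by
    intro z hz h0
    rcases h0.eq_or_lt with h0 | h0
    · have : 0 < z.re := hz.resolve_right (by simp [← h0])
      exact .of_forall fun l => by simpa [← h0] using this
    · exact (tendsto_atTop_add_const_left _ _
        (tendsto_id.atTop_mul_const h0)).eventually_gt_atTop 0
  have key' : ∀ z : ℂ, (0 < z.re ∨ z.im ≠ 0) → z.im ≤ 0 →
      ∀ᶠ l : ℝ in atTop, 0 < z.re + (-l) * z.im := by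
    intro z hz h0
    simpa using key (conj z) (by simpa using hz) (by simpa using h0)
  rcases h with h | ⟨h, hab⟩
  · rcases mul_nonneg_iff.1 h with ⟨h1, h2⟩ | ⟨h1, h2⟩
    · obtain ⟨l, hl⟩ := ((key a ha h1).and (key b hb h2)).exists
      exact ⟨l, hl⟩
    · obtain ⟨l, hl⟩ := ((key' a ha h1).and (key' b hb h2)).exists
      exact ⟨-l, hl⟩
  · rw [div_mul_eq_mul_div, mul_div_assoc] at hab
    rcases mul_neg_iff.1 h with ⟨h1, h2⟩ | ⟨h1, h2⟩
    · have h3 : -a.re / a.im < -b.re / b.im := by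
        rw [neg_div, neg_div, neg_lt_neg_iff, div_lt_iff_of_neg' h2]
        exact hab
      obtain ⟨l, hl1, hl2⟩ := exists_between h3
      refine ⟨l, ?_, ?_⟩
      · rw [div_lt_iff₀ h1] at hl1; dsimp; linarith
      · rw [lt_div_iff_of_neg h2] at hl2; dsimp; linarith
    · have h3 : -b.re / b.im < -a.re / a.im := by
        rw [neg_div, neg_div, neg_lt_neg_iff, lt_div_iff₀' h2]
        exact hab
      obtain ⟨l, hl1, hl2⟩ := exists_between h3
      refine ⟨l, ?_, ?_⟩
      · rw [lt_div_iff_of_neg h1] at hl2; dsimp; linarith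
      · rw [div_lt_iff₀ h2] at hl1; dsimp; linarith

/-- A coercive multiplier can be chosen continuously on the set of admissible pairs. -/
theorem exists_continuousOn_multiplier : ∃ l : ℂ × ℂ → ℝ,
    ContinuousOn l {p : ℂ × ℂ | Admissible p.1 p.2} ∧
      ∀ p : ℂ × ℂ, Admissible p.1 p.2 → l p ∈ coerciveMultipliers p := by
  classical
  -- Continuous selection by partition of unity: each set of multipliers is convex, and a multiplier
  -- good at one pair stays good at nearby pairs because the conditions are open.
  obtain ⟨g, hg⟩ := exists_continuous_forall_mem_convex_of_local_const
    (X := {p : ℂ × ℂ | Admissible p.1 p.2}) (t := fun p => coerciveMultipliers p.1)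
    (fun p => by
      intro x hx y hy s t hs ht hst
      obtain ⟨h1, h2⟩ := hx
      obtain ⟨h3, h4⟩ := hy
      have e : t = 1 - s := by linarith
      have hm : ∀ A B : ℝ, 0 < A → 0 < B → 0 < s * A + t * B := by
        intro A B hA hB
        rcases hs.eq_or_lt with h | h
        · have : t = 1 := by linarith
          rw [← h, this]; linarith
        · have := mul_pos h hA
          have := mul_nonneg ht hB.le
          linarith
      constructor
      · have := hm _ _ h1 h3
        subst e
        simp only [smul_eq_mul]
        linarith
      · have := hm _ _ h2 h4
        subst e
        simp only [smul_eq_mul]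
        linarith)
    (fun p => by
      obtain ⟨l, h1, h2⟩ := p.2.exists_multiplier
      refine ⟨l, ?_⟩
      have hc1 : Continuous fun q : {p : ℂ × ℂ | Admissible p.1 p.2} =>
          q.1.1.re + l * q.1.1.im := by fun_prop
      have hc2 : Continuous fun q : {p : ℂ × ℂ | Admissible p.1 p.2} =>
          q.1.2.re + l * q.1.2.im := by fun_prop
      exact (hc1.continuousAt.eventually_const_lt h1).and
        (hc2.continuousAt.eventually_const_lt h2))
  refine ⟨fun p => if h : Admissible p.1 p.2 then g ⟨p, h⟩ else 0, ?_, ?_⟩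
  · rw [continuousOn_iff_continuous_domRestrict]
    refine g.continuous.congr fun q => ?_
    rw [domRestrict_apply, dif_pos (show Admissible q.1.1 q.1.2 from q.2)]
  · intro p hp
    dsimp only
    rw [dif_pos hp]
    exact hg ⟨p, hp⟩

/-! ### Square integrals -/

theorem eLpNorm_two_sq {α E : Type*} [MeasurableSpace α] {μ : Measure α} [NormedAddCommGroup E]
    (f : α → E) : eLpNorm f 2 μ ^ 2 = ∫⁻ x, ‖f x‖ₑ ^ 2 ∂μ := by
  have := eLpNorm_nnreal_pow_eq_lintegral (f := f) (μ := μ) (p := 2) (by norm_num)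
  simpa using this

/-- Jensen's inequality, as Hölder against the constant 1. It serves averages over a mollifier and
over a segment. -/
theorem sq_lintegral_le {α : Type*} [MeasurableSpace α] {m : Measure α} [IsProbabilityMeasure m]
    {f : α → ℝ≥0∞} (hf : AEMeasurable f m) : (∫⁻ x, f x ∂m) ^ 2 ≤ ∫⁻ x, f x ^ 2 ∂m := by
  have h := ENNReal.lintegral_mul_le_Lp_mul_Lq m Real.HolderConjugate.two_two hf
    (aemeasurable_const (b := (1 : ℝ≥0∞)))
  have h2 := pow_le_pow_left₀ zero_le h 2
  simp only [Pi.mul_apply, mul_one, ENNReal.one_rpow, lintegral_const, measure_univ] at h2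
  refine h2.trans ?_
  rw [← ENNReal.rpow_natCast, ← ENNReal.rpow_mul]
  simp

theorem eLpNorm_comp_sub_right {N : ℕ} {E : Type*} [NormedAddCommGroup E] {f : Space N → E}
    (hf : StronglyMeasurable f) (h : Space N) (p : ℝ≥0∞) :
    eLpNorm (fun x => f (x - h)) p volume = eLpNorm f p volume :=
  eLpNorm_comp_measurePreserving hf.aestronglyMeasurable (measurePreserving_sub_right volume h)

/-- Continuity of translations in `L²`. -/
theorem exists_eLpNorm_translate_sub_le {N : ℕ} {E : Type*} [NormedAddCommGroup E]
    {f : Space N → E} (hf : MemLp f 2 volume) {ε : ℝ≥0∞} (hε : 0 < ε) :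
    ∃ δ > 0, ∀ h : Space N, ‖h‖ < δ →
      eLpNorm (fun x => f (x - h) - f x) 2 volume < ε := by
  -- Translations form a continuous family of measure preserving maps in the compact-open topology,
  -- so composing a fixed `L²` class with them is continuous in `h`.
  let T : Space N → C(Space N, Space N) := fun h => ⟨fun x => x - h, by fun_prop⟩
  have hT : Continuous T := by
    refine ContinuousMap.continuous_of_continuous_uncurry _ ?_
    simp only [T, Function.uncurry_def, ContinuousMap.coe_mk]
    fun_prop
  have hmp : ∀ h, MeasurePreserving (T h) volume volume :=
    fun h => measurePreserving_sub_right volume h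
  have hc := Continuous.compMeasurePreservingLp (f := fun _ : Space N => hf.toLp f)
    continuous_const hT hmp (by simp)
  have h0 := (EMetric.continuous_iff.1 hc) 0 ε hε
  obtain ⟨δ, hδ, h0⟩ := h0
  obtain ⟨δ', hδ', hd⟩ : ∃ δ' : ℝ, 0 < δ' ∧ ENNReal.ofReal δ' ≤ δ := by
    rcases eq_or_ne δ ⊤ with h | h
    · exact ⟨1, one_pos, h ▸ le_top⟩
    · exact ⟨δ.toReal, ENNReal.toReal_pos hδ.ne' h, ENNReal.ofReal_toReal_le⟩
  refine ⟨δ', hδ', fun h hh => ?_⟩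
  have h1 := h0 h (by
    rw [edist_eq_enorm_sub, sub_zero]
    refine lt_of_lt_of_le ?_ hd
    rw [← ofReal_norm]
    exact (ENNReal.ofReal_lt_ofReal_iff hδ').2 hh)
  rw [Lp.edist_def] at h1
  refine lt_of_eq_of_lt (eLpNorm_congr_ae ?_) h1
  have e1 := Lp.coeFn_compMeasurePreserving (hf.toLp f) (hmp h)
  have e2 := Lp.coeFn_compMeasurePreserving (hf.toLp f) (hmp 0)
  have e3 := (hmp h).quasiMeasurePreserving.ae_eq_comp hf.coeFn_toLp
  have e4 := (hmp 0).quasiMeasurePreserving.ae_eq_comp hf.coeFn_toLp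
  filter_upwards [e1, e2, e3, e4] with x h1 h2 h3 h4
  simp only [Pi.sub_apply]
  rw [h1, h2, h3, h4]
  simp [T]

section Mollification

open ContinuousLinearMap
open scoped Convolution

/-! ### Mollification -/

/-- The difference is the average of `f(· - t) - f` for the probability density `ρ`, so Jensen and
Tonelli reduce it to translations with `|t| < δ`. Strong measurability gives joint measurability in
`(x, t)`. -/
theorem exists_eLpNorm_convolution_sub_le {N : ℕ} {E : Type*} [NormedAddCommGroup E]
    [NormedSpace ℝ E] [CompleteSpace E] {f : Space N → E} (hfm : StronglyMeasurable f)
    (hf : MemLp f 2 volume) {ε : ℝ≥0∞} (hε : 0 < ε) :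
    ∃ δ > 0, ∀ ρ : ContDiffBump (0 : Space N), ρ.rOut < δ →
      eLpNorm (fun x => (ρ.normed volume ⋆[lsmul ℝ ℝ, volume] f) x - f x) 2 volume ≤ ε := by
  obtain ⟨δ, hδ, H⟩ := exists_eLpNorm_translate_sub_le hf hε
  refine ⟨δ, hδ, fun ρ hρ => ?_⟩
  set r : Space N → ℝ := ρ.normed volume with hr
  have hr0 : ∀ x, 0 ≤ r x := fun x => ρ.nonneg_normed x
  have hrm : Measurable r := ρ.continuous_normed.measurable
  set m : Measure (Space N) := volume.withDensity fun t => ENNReal.ofReal (r t) with hm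
  have hd : ∀ φ : Space N → ℝ≥0∞,
      ∫⁻ t, φ t ∂m = ∫⁻ t, ENNReal.ofReal (r t) * φ t :=
    fun φ => by
      rw [hm, lintegral_withDensity_eq_lintegral_mul_non_measurable _ (by fun_prop) (by simp)]
      rfl
  have : IsProbabilityMeasure m := ⟨by
    rw [← lintegral_one, hd]
    simp only [mul_one]
    rw [← ofReal_integral_eq_lintegral_ofReal ρ.integrable_normed (.of_forall hr0),
      ρ.integral_normed, ENNReal.ofReal_one]⟩
  have hjm : Measurable fun z : Space N × Space N => ‖f (z.1 - z.2) - f z.1‖ₑ :=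
    ((hfm.comp_measurable (measurable_fst.sub measurable_snd)).sub
      (hfm.comp_measurable measurable_fst)).enorm
  have hpt : ∀ x, ‖(r ⋆[lsmul ℝ ℝ, volume] f) x - f x‖ₑ ^ 2
      ≤ ∫⁻ t, ‖f (x - t) - f x‖ₑ ^ 2 ∂m := by
    intro x
    refine le_trans ?_ (sq_lintegral_le (m := m) (f := fun t => ‖f (x - t) - f x‖ₑ)
      (hjm.comp (measurable_const.prodMk measurable_id)).aemeasurable)
    gcongr
    have e1 : (r ⋆[lsmul ℝ ℝ, volume] f) x - f x = ∫ t, r t • (f (x - t) - f x) := by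
      have h1 : Integrable (fun t => r t • f (x - t)) volume :=
        ρ.hasCompactSupport_normed.convolutionExists_left (lsmul ℝ ℝ) ρ.continuous_normed
          (hf.locallyIntegrable (by norm_num)) x
      have h2 : Integrable (fun t => r t • f x) volume := ρ.integrable_normed.smul_const _
      simp_rw [smul_sub]
      rw [integral_sub h1 h2, hr, ρ.integral_normed_smul]
      rfl
    rw [e1, hd]
    refine (enorm_integral_le_lintegral_enorm _).trans (le_of_eq (lintegral_congr fun t => ?_))
    rw [enorm_smul, Real.enorm_of_nonneg (hr0 t)]
  rw [← ENNReal.pow_le_pow_left_iff two_ne_zero, eLpNorm_two_sq]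
  calc ∫⁻ x, ‖(r ⋆[lsmul ℝ ℝ, volume] f) x - f x‖ₑ ^ 2
      ≤ ∫⁻ x, ∫⁻ t, ‖f (x - t) - f x‖ₑ ^ 2 ∂m := lintegral_mono hpt
    _ = ∫⁻ t, (∫⁻ x, ‖f (x - t) - f x‖ₑ ^ 2) ∂m := by
        refine lintegral_lintegral_swap ?_
        exact (hjm.pow_const 2).aemeasurable
    _ = ∫⁻ t, ENNReal.ofReal (r t) * ∫⁻ x, ‖f (x - t) - f x‖ₑ ^ 2 := hd _
    _ ≤ ∫⁻ t, ENNReal.ofReal (r t) * ε ^ 2 := by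
        refine lintegral_mono fun t => ?_
        by_cases ht : ‖t‖ < δ
        · dsimp only
          gcongr
          rw [← eLpNorm_two_sq]
          gcongr
          exact (H t ht).le
        · have : r t = 0 := by
            rw [← Function.notMem_support, hr, ρ.support_normed_eq, mem_ball_zero_iff]
            exact fun h => ht (h.trans hρ)
          simp [this]
    _ = ∫⁻ _, ε ^ 2 ∂m := (hd _).symm
    _ = ε ^ 2 := by simp

/-- The classical gradient of a smooth function. -/
def smoothGrad {N : ℕ} (ψ : Space N → ℂ) (x : Space N) : EuclideanSpace ℂ (Fin N) :=
  WithLp.toLp 2 fun j => fderiv ℝ ψ x (EuclideanSpace.single j 1)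

/-- The derivative falls on `ρ`, and `ρ(x - ·)` is itself a legitimate test function for the weak
gradient; the sign from reflecting the variable cancels the one from integration by parts. -/
theorem smoothGrad_convolution {N : ℕ} {w : Space N → ℂ} {g : Space N → EuclideanSpace ℂ (Fin N)}
    (hw : LocallyIntegrable w volume) (hg : LocallyIntegrable g volume)
    (hwg : HasWeakGradient w g) {ρ : Space N → ℝ} (hρ : ContDiff ℝ ∞ ρ)
    (hc : HasCompactSupport ρ) :
    smoothGrad (ρ ⋆[lsmul ℝ ℝ, volume] w) = ρ ⋆[lsmul ℝ ℝ, volume] g := by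
  ext x j
  have hρ1 : ContDiff ℝ 1 ρ := hρ.of_le (by simp)
  have h1 := hc.hasFDerivAt_convolution_left (lsmul ℝ ℝ : ℝ →L[ℝ] ℂ →L[ℝ] ℂ) hρ1 hw x
  have hT : ContDiff ℝ ∞ fun y => ρ (x - y) := hρ.comp (contDiff_const.sub contDiff_id)
  have hTc : HasCompactSupport fun y => ρ (x - y) :=
    hc.comp_homeomorph (Homeomorph.subLeft x)
  have h2 := hwg _ hT hTc j
  have h3 : ∀ y, fderiv ℝ (fun y => ρ (x - y)) y (EuclideanSpace.single j 1)
      = - fderiv ℝ ρ (x - y) (EuclideanSpace.single j 1) := by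
    intro y
    have := ((hρ1.differentiable one_ne_zero) (x - y)).hasFDerivAt.comp y
      ((hasFDerivAt_id y).const_sub x)
    have e := this.fderiv
    simp only [Function.comp_def] at e
    rw [e]
    simp
  simp only [h3, neg_smul, integral_neg, neg_inj] at h2
  have h4 : (ρ ⋆[lsmul ℝ ℝ, volume] g) x j = ∫ y, ρ (x - y) • g y j := by
    rw [convolution_eq_swap]
    have hi : Integrable (fun y => ρ (x - y) • g y) volume := by
      have := hc.convolutionExists_left (lsmul ℝ ℝ) hρ.continuous hg x
      exact this.integrable_swap
    exact ((EuclideanSpace.proj (𝕜 := ℂ) j : EuclideanSpace ℂ (Fin N) →L[ℂ] ℂ).integral_comp_comm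
      hi).symm
  rw [h4, ← h2]
  change fderiv ℝ (ρ ⋆[lsmul ℝ ℝ, volume] w) x (EuclideanSpace.single j 1) = _
  rw [h1.fderiv, convolution_eq_swap, ContinuousLinearMap.integral_apply]
  · rfl
  · have := (hc.fderiv ℝ).convolutionExists_left ((lsmul ℝ ℝ : ℝ →L[ℝ] ℂ →L[ℝ] ℂ).precompL (Space N))
      (hρ1.continuous_fderiv one_ne_zero) hw x
    exact this.integrable_swap

/-- Compactly supported Sobolev functions are limits in `H¹` of test functions supported nearby. -/
theorem exists_smooth_approx {N : ℕ} {w : Space N → ℂ} {g : Space N → EuclideanSpace ℂ (Fin N)}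
    (hwm : StronglyMeasurable w) (hgm : StronglyMeasurable g)
    (hw : MemLp w 2 volume) (hg : MemLp g 2 volume) (hwg : HasWeakGradient w g)
    {x₀ : Space N} {R : ℝ} (hs : Function.support w ⊆ closedBall x₀ R) {ε : ℝ≥0∞} (hε : 0 < ε) :
    ∃ ψ : Space N → ℂ, ContDiff ℝ ∞ ψ ∧ Function.support ψ ⊆ closedBall x₀ (R + 1) ∧
      eLpNorm (fun x => ψ x - w x) 2 volume ≤ ε ∧
      eLpNorm (fun x => smoothGrad ψ x - g x) 2 volume ≤ ε := by
  obtain ⟨δ₁, h1, H1⟩ := exists_eLpNorm_convolution_sub_le hwm hw hε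
  obtain ⟨δ₂, h2, H2⟩ := exists_eLpNorm_convolution_sub_le hgm hg hε
  -- Capping the mollification radius by 1 keeps the support within radius `R + 1`.
  set s := min (min δ₁ δ₂) 1 / 2 with hs'
  have hmin : 0 < min (min δ₁ δ₂) 1 := by positivity
  have hs0 : 0 < s := by positivity
  have hsm : s < min (min δ₁ δ₂) 1 := by rw [hs']; linarith
  let ρ : ContDiffBump (0 : Space N) := ⟨s / 2, s, by positivity, by linarith⟩
  have hwl : LocallyIntegrable w volume := hw.locallyIntegrable (by norm_num)
  have hgl : LocallyIntegrable g volume := hg.locallyIntegrable (by norm_num)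
  refine ⟨ρ.normed volume ⋆[lsmul ℝ ℝ, volume] w, ?_, ?_, ?_, ?_⟩
  · exact ρ.hasCompactSupport_normed.contDiff_convolution_left _ ρ.contDiff_normed hwl
  · refine (support_convolution_subset (lsmul ℝ ℝ)).trans ?_
    rintro _ ⟨y, hy, z, hz, rfl⟩
    have hz := hs hz
    rw [ρ.support_normed_eq, mem_ball_zero_iff] at hy
    have : ρ.rOut = s := rfl
    rw [mem_closedBall, dist_eq_norm] at hz ⊢
    have h5 : s < 1 := hsm.trans_le (min_le_right _ _)
    calc ‖y + z - x₀‖ = ‖y + (z - x₀)‖ := by rw [add_sub_assoc]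
      _ ≤ ‖y‖ + ‖z - x₀‖ := norm_add_le _ _
      _ ≤ R + 1 := by linarith
  · exact H1 ρ (hsm.trans_le ((min_le_left _ _).trans (min_le_left _ _)))
  · rw [smoothGrad_convolution hwl hgl hwg ρ.contDiff_normed ρ.hasCompactSupport_normed]
    exact H2 ρ (hsm.trans_le ((min_le_left _ _).trans (min_le_right _ _)))

end Mollification

/-! ### A Nash type inequality -/

theorem norm_fderiv_apply_le {N : ℕ} (ψ : Space N → ℂ) (x h : Space N) :
    ‖fderiv ℝ ψ x h‖ ≤ ‖h‖ * ‖smoothGrad ψ x‖ := by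
  have e : fderiv ℝ ψ x h = ∑ j, h j • smoothGrad ψ x j := by
    conv_lhs => rw [← (EuclideanSpace.basisFun (Fin N) ℝ).sum_repr h]
    simp [smoothGrad]
  rw [e, EuclideanSpace.norm_eq, EuclideanSpace.norm_eq]
  refine (norm_sum_le _ _).trans ?_
  simp_rw [norm_smul]
  exact Real.sum_mul_le_sqrt_mul_sqrt _ _ _

/-- Integrate the derivative along the segment from `x` to `x - h`, then use Jensen, Tonelli and
translation invariance. -/
theorem eLpNorm_translate_sub_le_of_contDiff {N : ℕ} {ψ : Space N → ℂ} (hψ : ContDiff ℝ ∞ ψ)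
    (h : Space N) :
    eLpNorm (fun x => ψ (x - h) - ψ x) 2 volume ≤ ‖h‖ₑ * eLpNorm (smoothGrad ψ) 2 volume := by
  have hψ1 : ContDiff ℝ 1 ψ := hψ.of_le (by simp)
  have hgc : Continuous (smoothGrad ψ) := by
    refine (PiLp.continuous_toLp 2 _).comp (continuous_pi fun j => ?_)
    exact (hψ1.continuous_fderiv one_ne_zero).clm_apply continuous_const
  set m : Measure ℝ := volume.restrict (Ioc 0 1) with hm
  have : IsProbabilityMeasure m := ⟨by simp [hm]⟩
  have hpt : ∀ x, ‖ψ (x - h) - ψ x‖ₑ ^ 2 ≤ ∫⁻ s, (‖h‖ₑ * ‖smoothGrad ψ (x - s • h)‖ₑ) ^ 2 ∂m := by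
    intro x
    refine le_trans ?_ (sq_lintegral_le (m := m) (by fun_prop))
    gcongr
    have hd : ∀ s : ℝ, HasDerivAt (fun s : ℝ => ψ (x - s • h)) (-fderiv ℝ ψ (x - s • h) h) s := by
      intro s
      have h1 := ((hψ1.differentiable one_ne_zero) (x - s • h)).hasFDerivAt.comp_hasDerivAt s
        (((hasDerivAt_id s).smul_const h).const_sub x)
      exact h1.congr_deriv (by simp)
    have e := intervalIntegral.integral_eq_sub_of_hasDerivAt (a := 0) (b := 1)
      (fun s _ => hd s) (by
        refine Continuous.intervalIntegrable ?_ _ _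
        refine Continuous.neg ?_
        exact ((hψ1.continuous_fderiv one_ne_zero).comp (by fun_prop)).clm_apply continuous_const)
    simp only [one_smul, zero_smul, sub_zero] at e
    rw [← e, intervalIntegral.integral_of_le zero_le_one]
    refine (enorm_integral_le_lintegral_enorm _).trans (lintegral_mono fun s => ?_)
    rw [enorm_neg, ← ofReal_norm, ← ofReal_norm h, ← ofReal_norm (smoothGrad ψ _),
      ← ENNReal.ofReal_mul (norm_nonneg _)]
    exact ENNReal.ofReal_le_ofReal (norm_fderiv_apply_le _ _ _)
  rw [← ENNReal.pow_le_pow_left_iff two_ne_zero, eLpNorm_two_sq]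
  calc ∫⁻ x, ‖ψ (x - h) - ψ x‖ₑ ^ 2
      ≤ ∫⁻ x, ∫⁻ s, (‖h‖ₑ * ‖smoothGrad ψ (x - s • h)‖ₑ) ^ 2 ∂m := lintegral_mono hpt
    _ = ∫⁻ s, (∫⁻ x, (‖h‖ₑ * ‖smoothGrad ψ (x - s • h)‖ₑ) ^ 2) ∂m := by
        refine lintegral_lintegral_swap (Continuous.aemeasurable ?_)
        simp only [Function.uncurry_def, ← enorm_norm (smoothGrad ψ _)]
        have : Continuous fun z : Space N × ℝ => ‖smoothGrad ψ (z.1 - z.2 • h)‖ₑ :=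
          (hgc.comp (by fun_prop)).enorm
        simp only [enorm_norm]
        exact (ENNReal.continuous_pow 2).comp
          ((ENNReal.continuous_const_mul enorm_ne_top).comp this)
    _ = ∫⁻ s, (‖h‖ₑ * eLpNorm (smoothGrad ψ) 2 volume) ^ 2 ∂m := by
        refine lintegral_congr fun s => ?_
        simp only [mul_pow]
        rw [lintegral_const_mul' _ _ (by finiteness), ← eLpNorm_two_sq,
          eLpNorm_comp_sub_right hgc.stronglyMeasurable]
    _ = _ := by simp

/-- The smooth case passes to the limit: an `ε`-approximation costs `‖h‖ ε` in the gradient and `ε`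
for each of the two values `w(x)`, `w(x - h)`. -/
theorem eLpNorm_translate_sub_le {N : ℕ} {w : Space N → ℂ} {g : Space N → EuclideanSpace ℂ (Fin N)}
    (hwm : StronglyMeasurable w) (hgm : StronglyMeasurable g)
    (hw : MemLp w 2 volume) (hg : MemLp g 2 volume) (hwg : HasWeakGradient w g)
    {x₀ : Space N} {R : ℝ} (hs : Function.support w ⊆ closedBall x₀ R) (h : Space N) :
    eLpNorm (fun x => w (x - h) - w x) 2 volume ≤ ‖h‖ₑ * eLpNorm g 2 volume := by
  have hε : ∀ ε : ℝ≥0∞, 0 < ε →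
      eLpNorm (fun x => w (x - h) - w x) 2 volume
        ≤ ‖h‖ₑ * (ε + eLpNorm g 2 volume) + (ε + ε) := by
    intro ε hε
    obtain ⟨ψ, hψ, -, h1, h2⟩ := exists_smooth_approx hwm hgm hw hg hwg hs hε
    have hψ1 : ContDiff ℝ 1 ψ := hψ.of_le (by simp)
    have hψm : StronglyMeasurable ψ := hψ.continuous.stronglyMeasurable
    have hgc : Continuous (smoothGrad ψ) := by
      refine (PiLp.continuous_toLp 2 _).comp (continuous_pi fun j => ?_)
      exact (hψ1.continuous_fderiv one_ne_zero).clm_apply continuous_const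
    have hτ : ∀ {f : Space N → ℂ}, StronglyMeasurable f →
        AEStronglyMeasurable (fun x => f (x - h)) volume := fun hf =>
      (hf.comp_measurable (measurable_id.sub_const h)).aestronglyMeasurable
    have e1 : (fun x => w (x - h) - w x) = (fun x => ψ (x - h) - ψ x) +
        ((fun x => ψ x - w x) - fun x => ψ (x - h) - w (x - h)) := by
      ext x; simp only [Pi.add_apply, Pi.sub_apply]; ring
    have e2 : eLpNorm (fun x => ψ (x - h) - w (x - h)) 2 volume ≤ ε := by
      rwa [eLpNorm_comp_sub_right (f := fun x => ψ x - w x) (hψm.sub hwm)]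
    have e3 : eLpNorm (smoothGrad ψ) 2 volume ≤ ε + eLpNorm g 2 volume := by
      have : smoothGrad ψ = (fun x => smoothGrad ψ x - g x) + g := by ext x; simp
      rw [this]
      refine (eLpNorm_add_le (hgc.stronglyMeasurable.sub hgm).aestronglyMeasurable
        hgm.aestronglyMeasurable (by norm_num)).trans (add_le_add h2 le_rfl)
    rw [e1]
    refine (eLpNorm_add_le ((hτ hψm).sub hψm.aestronglyMeasurable)
      ((hψm.sub hwm).aestronglyMeasurable.sub ((hτ hψm).sub (hτ hwm))) (by norm_num)).trans ?_
    refine add_le_add ((eLpNorm_translate_sub_le_of_contDiff hψ h).trans (by gcongr)) ?_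
    refine (eLpNorm_sub_le (hψm.sub hwm).aestronglyMeasurable ((hτ hψm).sub (hτ hwm))
      (by norm_num)).trans (add_le_add h1 e2)
  have ht : Tendsto (fun ε : ℝ≥0∞ => ‖h‖ₑ * (ε + eLpNorm g 2 volume) + (ε + ε)) (𝓝[>] 0)
      (𝓝 (‖h‖ₑ * (0 + eLpNorm g 2 volume) + (0 + 0))) := by
    have : Continuous fun ε : ℝ≥0∞ => ‖h‖ₑ * (ε + eLpNorm g 2 volume) + (ε + ε) := by
      refine ((ENNReal.continuous_const_mul enorm_ne_top).comp ?_).add ?_ <;> fun_prop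
    exact (this.tendsto 0).mono_left nhdsWithin_le_nhds
  have := ge_of_tendsto ht (eventually_nhdsWithin_of_forall fun ε hε' => hε ε hε')
  simpa using this

/-- Expand `(|b| - |a|)² ≤ |b - a|²` and drop `|b|²`. -/
theorem enorm_sq_le (a b : ℂ) : ‖a‖ₑ ^ 2 ≤ ‖b - a‖ₑ ^ 2 + 2 * (‖a‖ₑ * ‖b‖ₑ) := by
  simp only [← ofReal_norm]
  rw [← ENNReal.ofReal_pow (norm_nonneg _), ← ENNReal.ofReal_pow (norm_nonneg _),
    ← ENNReal.ofReal_mul (norm_nonneg _), ← ENNReal.ofReal_ofNat 2,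
    ← ENNReal.ofReal_mul (by norm_num), ← ENNReal.ofReal_add (by positivity) (by positivity)]
  refine ENNReal.ofReal_le_ofReal ?_
  have h := sq_le_sq' (abs_le.1 (abs_norm_sub_norm_le b a)).1 (abs_le.1 (abs_norm_sub_norm_le b a)).2
  nlinarith [sq_nonneg ‖b‖]

/-- Integrate over `h` in the ball the pointwise bound of `|w|²` by `|w(· - h) - w|²` and `2|w||w(·
- h)|`. The translation estimate handles the first term; in the second, letting `h` range over the
whole space produces `(∫|w|)²`. -/
theorem volume_ball_mul_lintegral_sq_le {N : ℕ} {w : Space N → ℂ}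
    {g : Space N → EuclideanSpace ℂ (Fin N)}
    (hwm : StronglyMeasurable w) (hgm : StronglyMeasurable g)
    (hw : MemLp w 2 volume) (hg : MemLp g 2 volume) (hwg : HasWeakGradient w g)
    {x₀ : Space N} {R : ℝ} (hs : Function.support w ⊆ closedBall x₀ R) {r : ℝ} :
    volume (ball (0 : Space N) r) * ∫⁻ x, ‖w x‖ₑ ^ 2 ≤
      volume (ball (0 : Space N) r) * (ENNReal.ofReal r ^ 2 * ∫⁻ x, ‖g x‖ₑ ^ 2)
        + 2 * (∫⁻ x, ‖w x‖ₑ) ^ 2 := by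
  set B := ball (0 : Space N) r
  have hm2 : Measurable fun z : Space N × Space N => w (z.2 - z.1) :=
    hwm.measurable.comp (measurable_snd.sub measurable_fst)
  calc volume B * ∫⁻ x, ‖w x‖ₑ ^ 2
      = ∫⁻ h in B, ∫⁻ x, ‖w x‖ₑ ^ 2 := by rw [setLIntegral_const, mul_comm]
    _ ≤ ∫⁻ h in B, ((ENNReal.ofReal r ^ 2 * ∫⁻ x, ‖g x‖ₑ ^ 2) +
          2 * ∫⁻ x, ‖w x‖ₑ * ‖w (x - h)‖ₑ) := by
        refine setLIntegral_mono' measurableSet_ball fun h hh => ?_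
        have hm1 : Measurable fun x => ‖w (x - h)‖ₑ :=
          (hwm.measurable.comp (measurable_id.sub_const h)).enorm
        calc ∫⁻ x, ‖w x‖ₑ ^ 2
            ≤ ∫⁻ x, (‖w (x - h) - w x‖ₑ ^ 2 + 2 * (‖w x‖ₑ * ‖w (x - h)‖ₑ)) :=
              lintegral_mono fun x => enorm_sq_le _ _
          _ = (∫⁻ x, ‖w (x - h) - w x‖ₑ ^ 2) + 2 * ∫⁻ x, ‖w x‖ₑ * ‖w (x - h)‖ₑ := by
              rw [lintegral_add_right, lintegral_const_mul]
              · exact hwm.measurable.enorm.mul hm1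
              · exact (show Measurable fun x => ‖w x‖ₑ * ‖w (x - h)‖ₑ from
                  hwm.measurable.enorm.mul hm1).const_mul 2
          _ ≤ _ := by
              gcongr
              rw [← eLpNorm_two_sq, ← eLpNorm_two_sq, ← mul_pow]
              gcongr
              refine (eLpNorm_translate_sub_le hwm hgm hw hg hwg hs h).trans ?_
              gcongr
              rw [← ofReal_norm]
              exact ENNReal.ofReal_le_ofReal (mem_ball_zero_iff.1 hh).le
    _ = volume B * (ENNReal.ofReal r ^ 2 * ∫⁻ x, ‖g x‖ₑ ^ 2)
          + 2 * ∫⁻ h in B, ∫⁻ x, ‖w x‖ₑ * ‖w (x - h)‖ₑ := by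
        rw [lintegral_add_left measurable_const, setLIntegral_const, mul_comm,
          lintegral_const_mul' _ _ (by simp)]
    _ ≤ _ := by
        gcongr
        calc ∫⁻ h in B, ∫⁻ x, ‖w x‖ₑ * ‖w (x - h)‖ₑ
            ≤ ∫⁻ h, ∫⁻ x, ‖w x‖ₑ * ‖w (x - h)‖ₑ := setLIntegral_le_lintegral _ _
          _ = ∫⁻ x, ∫⁻ h, ‖w x‖ₑ * ‖w (x - h)‖ₑ := by
              refine lintegral_lintegral_swap (Measurable.aemeasurable ?_)
              exact (hwm.measurable.comp measurable_snd).enorm.mul hm2.enorm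
          _ = ∫⁻ x, ‖w x‖ₑ * ∫⁻ h, ‖w h‖ₑ := by
              refine lintegral_congr fun x => ?_
              rw [lintegral_const_mul' _ _ enorm_ne_top,
                lintegral_sub_left_eq_self (fun y => ‖w y‖ₑ) x]
          _ = _ := by
              rw [lintegral_mul_const _ hwm.measurable.enorm, sq]

/-- **Nash type inequality.** -/
theorem integral_sq_le {N : ℕ} {w : Space N → ℂ} {g : Space N → EuclideanSpace ℂ (Fin N)}
    (hwm : StronglyMeasurable w) (hgm : StronglyMeasurable g)
    (hw : MemLp w 2 volume) (hg : MemLp g 2 volume) (hw1 : Integrable w volume)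
    (hwg : HasWeakGradient w g)
    {x₀ : Space N} {R : ℝ} (hs : Function.support w ⊆ closedBall x₀ R) {r : ℝ} (hr : 0 < r) :
    ∫ x, ‖w x‖ ^ 2 ≤ r ^ 2 * (∫ x, ‖g x‖ ^ 2)
      + 2 / (volume.real (ball (0 : Space N) 1) * r ^ N) * (∫ x, ‖w x‖) ^ 2 := by
  have h := volume_ball_mul_lintegral_sq_le hwm hgm hw hg hwg hs (r := r)
  have hv : 0 < volume.real (ball (0 : Space N) 1) :=
    ENNReal.toReal_pos (measure_ball_pos _ _ one_pos).ne' measure_ball_lt_top.ne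
  have hV : (volume (ball (0 : Space N) r)).toReal = volume.real (ball (0 : Space N) 1) * r ^ N := by
    rw [Measure.addHaar_ball_of_pos _ _ hr, ENNReal.toReal_mul, ENNReal.toReal_ofReal (by positivity)]
    simp [Measure.real, mul_comm]
  have hsq : ∀ {E : Type} [NormedAddCommGroup E] {f : Space N → E}, MemLp f 2 volume →
      ∫⁻ x, ‖f x‖ₑ ^ 2 = ENNReal.ofReal (∫ x, ‖f x‖ ^ 2) := by
    intro E _ f hf
    rw [ofReal_integral_eq_lintegral_ofReal (hf.integrable_norm_pow two_ne_zero)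
      (.of_forall fun x => by positivity)]
    refine lintegral_congr fun x => ?_
    rw [ENNReal.ofReal_pow (norm_nonneg _), ofReal_norm]
  have h1 : ∫⁻ x, ‖w x‖ₑ = ENNReal.ofReal (∫ x, ‖w x‖) :=
    (ofReal_integral_norm_eq_lintegral_enorm hw1).symm
  have h0 : 0 ≤ ∫ x, ‖w x‖ ^ 2 := integral_nonneg fun x => by positivity
  have h0' : 0 ≤ ∫ x, ‖g x‖ ^ 2 := integral_nonneg fun x => by positivity
  have h0'' : 0 ≤ ∫ x, ‖w x‖ := integral_nonneg fun x => by positivity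
  rw [hsq hw, hsq hg, h1] at h
  have h2 := ENNReal.toReal_mono (by finiteness) h
  rw [ENNReal.toReal_add (by finiteness) (by finiteness)] at h2
  simp only [ENNReal.toReal_mul, ENNReal.toReal_pow, ENNReal.toReal_ofReal h0,
    ENNReal.toReal_ofReal h0', ENNReal.toReal_ofReal h0'', ENNReal.toReal_ofReal hr.le, hV,
    ENNReal.toReal_ofNat] at h2
  have hp : 0 < volume.real (ball (0 : Space N) 1) * r ^ N := by positivity
  rw [div_mul_eq_mul_div, ← sub_le_iff_le_add', le_div_iff₀ hp]
  linarith

/-! ### Cutoff functions and the product rule -/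

/-- The gradient of a real function, seen as a complex vector field. -/
def realGrad {N : ℕ} (η : Space N → ℝ) (x : Space N) : EuclideanSpace ℂ (Fin N) :=
  WithLp.toLp 2 fun j => ((fderiv ℝ η x (EuclideanSpace.single j 1) : ℝ) : ℂ)

/-- Evaluating the derivative at its own gradient vector `v` gives `|v|² ≤ ‖L‖ |v|`. -/
theorem norm_realGrad_le {N : ℕ} (η : Space N → ℝ) (x : Space N) :
    ‖realGrad η x‖ ≤ ‖fderiv ℝ η x‖ := by
  set L := fderiv ℝ η x
  set v : Space N := WithLp.toLp 2 fun j => L (EuclideanSpace.single j 1) with hv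
  have h1 : ‖realGrad η x‖ = ‖v‖ := by
    simp [EuclideanSpace.norm_eq, realGrad, hv, L]
  have h2 : L v = ‖v‖ ^ 2 := by
    conv_lhs => rw [← (EuclideanSpace.basisFun (Fin N) ℝ).sum_repr v]
    rw [EuclideanSpace.norm_sq_eq]
    simp [hv, sq]
  have h3 := (le_abs_self _).trans (L.le_opNorm v)
  rw [h1]
  rcases (norm_nonneg v).eq_or_lt with h | h
  · rw [← h]; exact norm_nonneg _
  · rw [h2, sq] at h3
    exact le_of_mul_le_mul_right h3 h

theorem continuous_realGrad {N : ℕ} {η : Space N → ℝ} (hη : ContDiff ℝ ∞ η) :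
    Continuous (realGrad η) := by
  refine (PiLp.continuous_toLp 2 _).comp (continuous_pi fun j => ?_)
  exact Complex.continuous_ofReal.comp
    ((hη.continuous_fderiv (by simp)).clm_apply continuous_const)

theorem hasCompactSupport_realGrad {N : ℕ} {η : Space N → ℝ} (hc : HasCompactSupport η) :
    HasCompactSupport (realGrad η) := by
  refine (hc.fderiv ℝ).mono fun x hx => ?_
  rw [Function.mem_support] at hx ⊢
  exact fun h => hx (norm_eq_zero.1 (le_antisymm ((norm_realGrad_le η x).trans (by simp [h]))
    (norm_nonneg _)))

/-- Use `ψ η` as test function for `u` and apply the classical product rule. -/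
theorem HasWeakGradient.smul_smooth {N : ℕ} {u : Space N → ℂ}
    {g : Space N → EuclideanSpace ℂ (Fin N)} (h : HasWeakGradient u g)
    (hu : MemLp u 2 volume) (hg : MemLp g 2 volume) {η : Space N → ℝ}
    (hη : ContDiff ℝ ∞ η) (hc : HasCompactSupport η) :
    HasWeakGradient (fun x => (η x : ℂ) * u x)
      (fun x => (η x : ℂ) • g x + u x • realGrad η x) := by
  intro ψ hψ hψc j
  have hgj : MemLp (fun x => g x j) 2 (volume : Measure (Space N)) :=
    (EuclideanSpace.proj (𝕜 := ℂ) j : EuclideanSpace ℂ (Fin N) →L[ℂ] ℂ).comp_memLp' hg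
  have hprod := h (fun x => ψ x * η x) (hψ.mul hη) (hψc.mul_right) j
  obtain ⟨c1, s1⟩ := continuous_partial hψ hψc (EuclideanSpace.single j 1)
  obtain ⟨c2, s2⟩ := continuous_partial hη hc (EuclideanSpace.single j 1)
  have hf : ∀ x, fderiv ℝ (fun x => ψ x * η x) x (EuclideanSpace.single j 1)
      = ψ x * fderiv ℝ η x (EuclideanSpace.single j 1)
        + fderiv ℝ ψ x (EuclideanSpace.single j 1) * η x := by
    intro x
    rw [fderiv_fun_mul ((hψ.differentiable (by simp)) x) ((hη.differentiable (by simp)) x)]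
    simp [mul_comm]
  have i1 : Integrable (fun x => (ψ x * fderiv ℝ η x (EuclideanSpace.single j 1)) • u x) :=
    integrable_smul_of_memLp (hψ.continuous.mul c2) hψc.mul_right hu
  have i2 : Integrable (fun x => (fderiv ℝ ψ x (EuclideanSpace.single j 1) * η x) • u x) :=
    integrable_smul_of_memLp (c1.mul hη.continuous) s1.mul_right hu
  have i3 : Integrable (fun x => (ψ x * η x) • g x j) :=
    integrable_smul_of_memLp (hψ.continuous.mul hη.continuous) hψc.mul_right hgj
  simp only [hf, add_smul] at hprod
  rw [integral_add i1 i2] at hprod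
  have e1 : ∫ x, fderiv ℝ ψ x (EuclideanSpace.single j 1) • ((η x : ℂ) * u x)
      = ∫ x, (fderiv ℝ ψ x (EuclideanSpace.single j 1) * η x) • u x :=
    integral_congr_ae (.of_forall fun x => by simp [mul_assoc])
  have e2 : ∫ x, ψ x • ((η x : ℂ) • g x + u x • realGrad η x) j
      = ∫ x, ((ψ x * η x) • g x j
        + (ψ x * fderiv ℝ η x (EuclideanSpace.single j 1)) • u x) :=
    integral_congr_ae (.of_forall fun x => by
      simp only [realGrad, PiLp.add_apply, PiLp.smul_apply, smul_eq_mul, Complex.real_smul,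
        Complex.ofReal_mul]
      ring)
  rw [e1, e2, integral_add i3 i1]
  linear_combination hprod

theorem HasWeakGradient.const_mul {N : ℕ} {u : Space N → ℂ}
    {g : Space N → EuclideanSpace ℂ (Fin N)} (h : HasWeakGradient u g) (c : ℂ) :
    HasWeakGradient (fun x => c * u x) (fun x => c • g x) := by
  intro ψ hψ hψc j
  have := h ψ hψ hψc j
  simp only [PiLp.smul_apply, smul_eq_mul, Complex.real_smul, mul_left_comm _ c,
    integral_const_mul] at this ⊢
  rw [this, mul_neg]

theorem HasWeakGradient.congr {N : ℕ} {u u' : Space N → ℂ}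
    {g g' : Space N → EuclideanSpace ℂ (Fin N)} (h : HasWeakGradient u g)
    (hu : u =ᵐ[volume] u') (hg : g =ᵐ[volume] g') : HasWeakGradient u' g' := by
  intro ψ hψ hψc j
  have e1 : ∫ x, (fderiv ℝ ψ x (EuclideanSpace.single j 1)) • u x
      = ∫ x, (fderiv ℝ ψ x (EuclideanSpace.single j 1)) • u' x :=
    integral_congr_ae (by filter_upwards [hu] with x hx; rw [hx])
  have e2 : ∫ x, ψ x • g x j = ∫ x, ψ x • g' x j :=
    integral_congr_ae (by filter_upwards [hg] with x hx; rw [hx])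
  rw [← e1, ← e2, h ψ hψ hψc j]

theorem hasWeakGradient_smoothGrad {N : ℕ} {ψ : Space N → ℂ} (hψ : ContDiff ℝ ∞ ψ) :
    HasWeakGradient ψ (smoothGrad ψ) := by
  intro χ hχ hχc j
  obtain ⟨c1, s1⟩ := continuous_partial hχ hχc (EuclideanSpace.single j 1)
  have c2 : Continuous fun x => fderiv ℝ ψ x (EuclideanSpace.single j 1) :=
    (hψ.continuous_fderiv (by simp)).clm_apply continuous_const
  have := integral_smul_fderiv_eq_neg_fderiv_smul_of_integrable (μ := (volume : Measure (Space N)))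
    (f := χ) (g := ψ) (v := EuclideanSpace.single j 1)
    ((c1.smul hψ.continuous).integrable_of_hasCompactSupport s1.smul_right)
    ((hχ.continuous.smul c2).integrable_of_hasCompactSupport hχc.smul_right)
    ((hχ.continuous.smul hψ.continuous).integrable_of_hasCompactSupport hχc.smul_right)
    (fun x _ => (hχ.differentiable (by simp)) x) (fun x _ => (hψ.differentiable (by simp)) x)
  simp only [smoothGrad]
  rw [this, neg_neg]

/-- The element of `H¹` given by a function and a weak gradient. -/
def toH1 {N : ℕ} {u : Space N → ℂ} {g : Space N → EuclideanSpace ℂ (Fin N)}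
    (hu : MemLp u 2 volume) (hg : MemLp g 2 volume) (h : HasWeakGradient u g) : H1 N :=
  ⟨WithLp.toLp 2 (hu.toLp u, hg.toLp g), h.congr hu.coeFn_toLp.symm hg.coeFn_toLp.symm⟩

theorem funOf_toH1 {N : ℕ} {u : Space N → ℂ} {g : Space N → EuclideanSpace ℂ (Fin N)}
    (hu : MemLp u 2 volume) (hg : MemLp g 2 volume) (h : HasWeakGradient u g) :
    funOf (toH1 hu hg h) =ᵐ[volume] u := hu.coeFn_toLp

theorem gradOf_toH1 {N : ℕ} {u : Space N → ℂ} {g : Space N → EuclideanSpace ℂ (Fin N)}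
    (hu : MemLp u 2 volume) (hg : MemLp g 2 volume) (h : HasWeakGradient u g) :
    gradOf (toH1 hu hg h) =ᵐ[volume] g := hg.coeFn_toLp

/-- If `F` is a bounded function away from `K`, this remains true against all Sobolev functions
supported at a positive distance from `K`. -/
theorem RestrictsTo.apply_toH1 {N : ℕ} {F : HNegOne N} {K : Set (Space N)} {f : Space N → ℂ}
    (hF : RestrictsTo F Kᶜ f) {w : Space N → ℂ} {g : Space N → EuclideanSpace ℂ (Fin N)}
    (hwm : StronglyMeasurable w) (hgm : StronglyMeasurable g)
    (hw : MemLp w 2 volume) (hg : MemLp g 2 volume) (hwg : HasWeakGradient w g)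
    {x₀ : Space N} {R : ℝ} (hs : Function.support w ⊆ closedBall x₀ R)
    (hK : closedBall x₀ (R + 1) ⊆ Kᶜ) :
    F (toH1 hw hg hwg) = (∫ x in Kᶜ, f x * conj (w x)).re := by
  have hε : ∀ n : ℕ, (0 : ℝ≥0∞) < (n + 1 : ℝ≥0∞)⁻¹ := fun n => by
    rw [ENNReal.inv_pos]; finiteness
  choose ψ hψ hψs h1 h2 using fun n => exists_smooth_approx hwm hgm hw hg hwg hs (hε n)
  have hlim : Tendsto (fun n : ℕ => (n + 1 : ℝ≥0∞)⁻¹) atTop (𝓝 0) := by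
    have := (tendsto_add_atTop_iff_nat 1).2 ENNReal.tendsto_inv_nat_nhds_zero
    simpa using this
  have hts : ∀ n, tsupport (ψ n) ⊆ closedBall x₀ (R + 1) := fun n =>
    closure_minimal (hψs n) isClosed_closedBall
  have hcs : ∀ n, HasCompactSupport (ψ n) := fun n =>
    (isCompact_closedBall x₀ (R + 1)).of_isClosed_subset (isClosed_tsupport _) (hts n)
  have hψ2 : ∀ n, MemLp (ψ n) 2 volume := fun n =>
    (hψ n).continuous.memLp_of_hasCompactSupport (hcs n)
  have hgc : ∀ n, Continuous (smoothGrad (ψ n)) := fun n => by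
    refine (PiLp.continuous_toLp 2 _).comp (continuous_pi fun j => ?_)
    exact ((hψ n).continuous_fderiv (by simp)).clm_apply continuous_const
  have hg2 : ∀ n, MemLp (smoothGrad (ψ n)) 2 volume := fun n => by
    have hd : MemLp (fun x => smoothGrad (ψ n) x - g x) 2 volume :=
      ⟨((hgc n).stronglyMeasurable.sub hgm).aestronglyMeasurable,
        (h2 n).trans_lt (by finiteness)⟩
    have e : smoothGrad (ψ n) = (fun x => smoothGrad (ψ n) x - g x) + g := by ext x; simp
    rw [e]
    exact hd.add hg
  have hwk : ∀ n, HasWeakGradient (ψ n) (smoothGrad (ψ n)) := fun n =>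
    hasWeakGradient_smoothGrad (hψ n)
  have t1 : Tendsto (fun n => (hψ2 n).toLp (ψ n)) atTop (𝓝 (hw.toLp w)) := by
    rw [Lp.tendsto_Lp_iff_tendsto_eLpNorm'']
    exact tendsto_of_tendsto_of_tendsto_of_le_of_le tendsto_const_nhds hlim
      (fun _ => zero_le) h1
  have t2 : Tendsto (fun n => (hg2 n).toLp (smoothGrad (ψ n))) atTop (𝓝 (hg.toLp g)) := by
    rw [Lp.tendsto_Lp_iff_tendsto_eLpNorm'']
    exact tendsto_of_tendsto_of_tendsto_of_le_of_le tendsto_const_nhds hlim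
      (fun _ => zero_le) h2
  have t3 : Tendsto (fun n => toH1 (hψ2 n) (hg2 n) (hwk n)) atTop (𝓝 (toH1 hw hg hwg)) := by
    rw [tendsto_subtype_rng]
    exact ((WithLp.prod_continuous_toLp 2 _ _).tendsto _).comp (t1.prodMk_nhds t2)
  have t4 := (F.continuous.tendsto _).comp t3
  set B := closedBall x₀ (R + 1) with hB
  have hBm : MeasurableSet B := measurableSet_closedBall
  -- On a ball of finite volume the bounded `f` is square integrable, so the pairing becomes an `L²`
  -- inner product and passes to the limit.
  have hf2 : MemLp (B.indicator f) 2 volume := by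
    rw [memLp_indicator_iff_restrict hBm]
    have : IsFiniteMeasure ((volume : Measure (Space N)).restrict B) :=
      ⟨by rw [Measure.restrict_apply_univ]; exact measure_closedBall_lt_top⟩
    exact (hF.1.mono_measure (Measure.restrict_mono hK le_rfl)).mono_exponent le_top
  have hint : ∀ {φ : Space N → ℂ} (hφ : MemLp φ 2 volume), Function.support φ ⊆ B →
      ∫ x in Kᶜ, f x * conj (φ x) = inner ℂ (hφ.toLp φ) (hf2.toLp (B.indicator f)) := by
    intro φ hφ hφs
    have hz : ∀ x ∉ Kᶜ, B.indicator f x * conj (φ x) = 0 := fun x hx => by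
      rw [indicator_of_notMem fun h => hx (hK h), zero_mul]
    have e : ∀ x, B.indicator f x * conj (φ x) = f x * conj (φ x) := fun x => by
      by_cases hx : x ∈ B
      · rw [indicator_of_mem hx]
      · rw [Function.notMem_support.1 fun h => hx (hφs h)]; simp
    rw [L2.inner_def]
    calc ∫ x in Kᶜ, f x * conj (φ x) = ∫ x in Kᶜ, B.indicator f x * conj (φ x) := by simp_rw [e]
      _ = ∫ x, B.indicator f x * conj (φ x) :=
          setIntegral_eq_integral_of_forall_compl_eq_zero hz
      _ = _ := by
          refine integral_congr_ae ?_
          filter_upwards [hφ.coeFn_toLp, hf2.coeFn_toLp] with x h1 h2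
          rw [h1, h2, RCLike.inner_apply]
  have t5 : Tendsto (fun n => (∫ x in Kᶜ, f x * conj (ψ n x)).re) atTop
      (𝓝 (∫ x in Kᶜ, f x * conj (w x)).re) := by
    rw [hint hw (hs.trans (closedBall_subset_closedBall (by linarith)))]
    simp_rw [fun n => hint (hψ2 n) (hψs n)]
    exact (Complex.continuous_re.tendsto _).comp (t1.inner tendsto_const_nhds)
  refine tendsto_nhds_unique t4 (t5.congr fun n => ?_)
  exact (hF.2 (ψ n) (hψ n) (hcs n) ((hts n).trans hK) _ (funOf_toH1 _ _ _)).symm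

theorem exists_abs_deriv_smoothTransition_le :
    ∃ D : ℝ, 0 < D ∧ ∀ x, ‖deriv Real.smoothTransition x‖ ≤ D := by
  have hc : Continuous (deriv Real.smoothTransition) :=
    Real.smoothTransition.contDiff (n := 1).continuous_deriv le_rfl
  obtain ⟨C, hC⟩ := (isCompact_Icc (a := (0 : ℝ)) (b := 1)).exists_bound_of_continuousOn
    hc.continuousOn
  refine ⟨max C 1, by positivity, fun x => ?_⟩
  by_cases hx : x ∈ Icc (0 : ℝ) 1
  · exact (hC x hx).trans (le_max_left _ _)
  · have : deriv Real.smoothTransition x = 0 := by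
      rw [mem_Icc, not_and_or, not_le, not_le] at hx
      rcases hx with hx | hx
      · have : Real.smoothTransition =ᶠ[𝓝 x] fun _ => 0 := by
          filter_upwards [Iio_mem_nhds hx] with y hy
          exact Real.smoothTransition.zero_of_nonpos (le_of_lt hy)
        rw [this.deriv_eq]; simp
      · have : Real.smoothTransition =ᶠ[𝓝 x] fun _ => 1 := by
          filter_upwards [Ioi_mem_nhds hx] with y hy
          exact Real.smoothTransition.one_of_one_le (le_of_lt hy)
        rw [this.deriv_eq]; simp
    rw [this, norm_zero]
    positivity

/-- Smooth cutoff functions between concentric balls, with a gradient bound. -/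
theorem exists_cutoff : ∃ D : ℝ, 0 < D ∧ ∀ (N : ℕ) (x₀ : Space N) (s t : ℝ), 1 ≤ s → s < t →
    t ≤ 2 → ∃ η : Space N → ℝ, ContDiff ℝ ∞ η ∧ (∀ x, 0 ≤ η x) ∧ (∀ x, η x ≤ 1) ∧
      (∀ x ∈ closedBall x₀ s, η x = 1) ∧ Function.support η ⊆ closedBall x₀ t ∧
      ∀ x, ‖realGrad η x‖ ≤ D / (t - s) := by
  obtain ⟨D, hD, hDb⟩ := exists_abs_deriv_smoothTransition_le
  refine ⟨2 * D, by positivity, fun N x₀ s t hs hst ht => ?_⟩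
  have hq : 0 < t ^ 2 - s ^ 2 := by nlinarith
  -- The squared norm keeps `θ` smooth at the centre; `θ ≥ 1` on the inner ball and `θ ≤ 0` outside
  -- the outer one.
  let θ : Space N → ℝ := fun x => (t ^ 2 - s ^ 2)⁻¹ * (t ^ 2 - ‖x - x₀‖ ^ 2)
  have hθ : ContDiff ℝ ∞ θ :=
    contDiff_const.mul (contDiff_const.sub ((contDiff_id.sub contDiff_const).norm_sq ℝ))
  have hη : ContDiff ℝ ∞ fun x => Real.smoothTransition (θ x) :=
    Real.smoothTransition.contDiff.comp hθ
  have hsupp : Function.support (fun x => Real.smoothTransition (θ x)) ⊆ closedBall x₀ t := by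
    intro x hx
    by_contra hxt
    refine hx (Real.smoothTransition.zero_of_nonpos (mul_nonpos_of_nonneg_of_nonpos (inv_nonneg.2 hq.le) ?_))
    rw [mem_closedBall, dist_eq_norm, not_le] at hxt
    nlinarith
  refine ⟨fun x => Real.smoothTransition (θ x), hη, fun x => Real.smoothTransition.nonneg _,
    fun x => Real.smoothTransition.le_one _, fun x hx => ?_, hsupp, fun x => ?_⟩
  · refine Real.smoothTransition.one_of_one_le ((one_le_inv_mul₀ hq).2 ?_)
    rw [mem_closedBall, dist_eq_norm] at hx
    have := norm_nonneg (x - x₀)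
    nlinarith
  · refine (norm_realGrad_le _ _).trans ?_
    by_cases hx : x ∈ closedBall x₀ t
    · have h0 := ((hasFDerivAt_id (𝕜 := ℝ) x).sub_const x₀).norm_sq
      have h1 := (h0.const_sub (t ^ 2)).const_mul ((t ^ 2 - s ^ 2)⁻¹)
      have h2 : DifferentiableAt ℝ Real.smoothTransition (θ x) :=
        (Real.smoothTransition.contDiff (n := 1)).differentiable one_ne_zero _
      have h3 := h2.hasDerivAt.comp_hasFDerivAt x h1
      have h4 : fderiv ℝ (fun x => Real.smoothTransition (θ x)) x = _ := h3.fderiv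
      rw [h4, norm_smul, norm_smul, norm_neg, norm_inv, Real.norm_of_nonneg hq.le]
      rw [mem_closedBall, dist_eq_norm] at hx
      have h5 : ‖(2 • (innerSL ℝ (x - x₀)).comp (ContinuousLinearMap.id ℝ (Space N)) :
          Space N →L[ℝ] ℝ)‖ ≤ 4 := by
        refine (norm_nsmul_le).trans ?_
        rw [ContinuousLinearMap.comp_id, innerSL_apply_norm]
        norm_num; linarith
      -- As `s ≥ 1`, `t² - s² ≥ 2(t - s)`, and the gradient of the squared norm is at most `2t ≤ 4`;
      -- hence a constant independent of `N`.
      calc ‖deriv Real.smoothTransition (θ x)‖ * ((t ^ 2 - s ^ 2)⁻¹ * _)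
          ≤ D * ((2 * (t - s))⁻¹ * 4) := by
            gcongr
            · exact hDb _
            · nlinarith
            · exact h5
        _ = 2 * D / (t - s) := by
            have : t - s ≠ 0 := by linarith
            field_simp
            norm_num
    · have : (fun x => Real.smoothTransition (θ x)) =ᶠ[𝓝 x] fun _ => 0 := by
        filter_upwards [isClosed_closedBall.isOpen_compl.mem_nhds hx] with y hy
        exact Function.notMem_support.1 fun h => hy (hsupp h)
      rw [this.fderiv_eq]
      have : 0 < t - s := by linarith
      simp
      positivity

/-! ### The localized energy estimate -/

theorem realGrad_sq {N : ℕ} {η : Space N → ℝ} (hη : ContDiff ℝ ∞ η) (x : Space N) :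
    realGrad (fun x => η x ^ 2) x = ((2 * η x : ℝ) : ℂ) • realGrad η x := by
  ext j
  have h := ((hη.differentiable (by simp)) x).hasFDerivAt.pow 2
  have e : fderiv ℝ (fun x => η x ^ 2) x = _ := h.fderiv
  simp [realGrad, e]

section Localization

variable {N : ℕ} {u : Space N → ℂ} {g : Space N → EuclideanSpace ℂ (Fin N)} {η : Space N → ℝ}

theorem memLp_cutoff_mul (hu : MemLp u 2 volume) (hη : ContDiff ℝ ∞ η)
    (hc : HasCompactSupport η) : MemLp (fun x => (η x : ℂ) * u x) 2 volume := by
  have h1 : MemLp (fun x => (η x : ℂ)) ⊤ (volume : Measure (Space N)) :=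
    (Complex.continuous_ofReal.comp hη.continuous).memLp_top_of_hasCompactSupport
      (hc.comp_left (g := fun y : ℝ => (y : ℂ)) Complex.ofReal_zero) _
  exact hu.smul h1

theorem memLp_cutoff_grad (hu : MemLp u 2 volume) (hg : MemLp g 2 volume) (hη : ContDiff ℝ ∞ η)
    (hc : HasCompactSupport η) :
    MemLp (fun x => (η x : ℂ) • g x + u x • realGrad η x) 2 volume := by
  have h1 : MemLp (fun x => (η x : ℂ)) ⊤ (volume : Measure (Space N)) :=
    (Complex.continuous_ofReal.comp hη.continuous).memLp_top_of_hasCompactSupport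
      (hc.comp_left (g := fun y : ℝ => (y : ℂ)) Complex.ofReal_zero) _
  have h2 : MemLp (realGrad η) ⊤ (volume : Measure (Space N)) :=
    (continuous_realGrad hη).memLp_top_of_hasCompactSupport (hasCompactSupport_realGrad hc) _
  exact (hg.smul h1).add (h2.smul hu)

theorem integrable_cutoff_mul (hu : Integrable u volume) (hη : ContDiff ℝ ∞ η)
    (hc : HasCompactSupport η) : Integrable (fun x => (η x : ℂ) * u x) volume := by
  have h1 : MemLp (fun x => (η x : ℂ)) ⊤ (volume : Measure (Space N)) :=
    (Complex.continuous_ofReal.comp hη.continuous).memLp_top_of_hasCompactSupport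
      (hc.comp_left (g := fun y : ℝ => (y : ℂ)) Complex.ofReal_zero) _
  exact memLp_one_iff_integrable.1 ((memLp_one_iff_integrable.2 hu).smul h1)

theorem integrable_cutoff_mul_real {h : Space N → ℝ} (hh : Integrable h volume) {χ : Space N → ℝ}
    (hχ : Continuous χ) (hc : HasCompactSupport χ) : Integrable (fun x => χ x * h x) volume :=
  memLp_one_iff_integrable.1 ((memLp_one_iff_integrable.2 hh).smul
    (hχ.memLp_top_of_hasCompactSupport hc _))

theorem stronglyMeasurable_cutoff_grad (hum : StronglyMeasurable u) (hgm : StronglyMeasurable g)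
    (hη : ContDiff ℝ ∞ η) :
    StronglyMeasurable (fun x => (η x : ℂ) • g x + u x • realGrad η x) :=
  ((Complex.continuous_ofReal.comp hη.continuous).stronglyMeasurable.smul hgm).add
    (hum.smul (continuous_realGrad hη).stronglyMeasurable)

end Localization

/-- The pointwise bound behind the energy estimate. -/
theorem re_inner_cutoff_ge {V : Type*} [NormedAddCommGroup V] [InnerProductSpace ℂ V]
    (m z : ℂ) (hm : m.re = 1) (η : ℝ) (g p : V) :
    η ^ 2 * ‖g‖ ^ 2 / 2 - 2 * ‖m‖ ^ 2 * (‖p‖ ^ 2 * ‖z‖ ^ 2) ≤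
      (inner ℂ (m • (((η ^ 2 : ℝ) : ℂ) • g + z • ((2 * η : ℝ) : ℂ) • p)) g).re := by
  have e : inner ℂ (m • (((η ^ 2 : ℝ) : ℂ) • g + z • ((2 * η : ℝ) : ℂ) • p)) g
      = conj m * ((η ^ 2 * ‖g‖ ^ 2 : ℝ) : ℂ) + ((2 * η : ℝ) : ℂ) * (conj m * conj z * inner ℂ p g) := by
    simp only [inner_smul_left, inner_add_left, inner_self_eq_norm_sq_to_K, Complex.conj_ofReal]
    push_cast
    simp only [Complex.coe_algebraMap]
    ring
  have h1 : |((conj m * conj z * inner ℂ p g).re)| ≤ ‖m‖ * ‖z‖ * (‖p‖ * ‖g‖) := by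
    refine (Complex.abs_re_le_norm _).trans ?_
    rw [norm_mul, norm_mul, Complex.norm_conj, Complex.norm_conj]
    gcongr
    exact norm_inner_le_norm _ _
  rw [e, Complex.add_re, Complex.re_mul_ofReal, Complex.conj_re, hm, one_mul, Complex.re_ofReal_mul]
  have h2 : -(2 * |η| * (‖m‖ * ‖z‖ * (‖p‖ * ‖g‖))) ≤
      2 * η * (conj m * conj z * inner ℂ p g).re := by
    have h3 : |2 * η * (conj m * conj z * inner ℂ p g).re|
        ≤ 2 * |η| * (‖m‖ * ‖z‖ * (‖p‖ * ‖g‖)) := by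
      rw [abs_mul, abs_mul, abs_two]
      gcongr
    exact (abs_le.1 h3).1
  -- Young's inequality, weighted to spend exactly half of `η²|g|²` on the cross term.
  nlinarith [sq_nonneg (|η| * ‖g‖ - 2 * (‖m‖ * (‖p‖ * ‖z‖))), sq_abs η]

/-- **Localized energy estimate** for solutions with a small bounded right-hand side. -/
theorem IsGlobalWeakSolution.energy_le {N : ℕ} {a b : ℂ} {φ : Space N → ℝ} {F : HNegOne N}
    {u : H1 N} {U : Space N → ℂ} (hsol : IsGlobalWeakSolution a b φ F u U)
    (hφ : ∀ᵐ x, 0 ≤ φ x) {l : ℝ} (hα : 0 < a.re + l * a.im)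
    {K : Set (Space N)} {f : Space N → ℂ} (hF : RestrictsTo F Kᶜ f)
    (hf : eLpNorm f ⊤ (volume.restrict Kᶜ) ≤
      ENNReal.ofReal ((a.re + l * a.im) / (2 * ‖1 + l * Complex.I‖)))
    {x₀ : Space N} {R : ℝ} (hR : closedBall x₀ (R + 1) ⊆ Kᶜ) {η : Space N → ℝ}
    (hη : ContDiff ℝ ∞ η) (hs : Function.support η ⊆ closedBall x₀ R) :
    (∫ x, η x ^ 2 * ‖gradOf u x‖ ^ 2) / 2 + (a.re + l * a.im) / 2 * (∫ x, η x ^ 2 * ‖funOf u x‖)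
      + (b.re + l * b.im) * (∫ x, η x ^ 2 * ‖funOf u x‖ ^ 2)
      ≤ 2 * ‖1 + l * Complex.I‖ ^ 2 * ∫ x, ‖realGrad η x‖ ^ 2 * ‖funOf u x‖ ^ 2 := by
  obtain ⟨hu1, hU, heq⟩ := hsol
  set α := a.re + l * a.im with hαdef
  set m : ℂ := 1 + l * Complex.I with hm
  have hmre : m.re = 1 := by simp [hm]
  have hm0 : 0 < ‖m‖ := norm_pos_iff.2 fun h => by simp [h] at hmre
  -- The test function enters conjugated, so the multiplier turns `a` and `b` into the two coercive
  -- constants, while `Re m = 1` leaves the gradient and potential terms unweighted.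
  have hconj : ∀ z : ℂ, (z * conj m).re = z.re + l * z.im := fun z => by
    simp [hm, mul_comm]
  set w₀ := funOf u with hw₀
  set g₀ := gradOf u with hg₀
  have hu2 : MemLp w₀ 2 volume := Lp.memLp _
  have hg2 : MemLp g₀ 2 volume := Lp.memLp _
  have hum : StronglyMeasurable w₀ := Lp.stronglyMeasurable _
  have hgm : StronglyMeasurable g₀ := Lp.stronglyMeasurable _
  have hug : HasWeakGradient w₀ g₀ := u.2
  have hc : HasCompactSupport η :=
    (isCompact_closedBall x₀ R).of_isClosed_subset (isClosed_tsupport _)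
      (closure_minimal hs isClosed_closedBall)
  -- Squaring the cutoff keeps a factor `η` in `∇χ = 2η∇η`, so the cross term can be absorbed.
  set χ : Space N → ℝ := fun x => η x ^ 2 with hχdef
  have hχ : ContDiff ℝ ∞ χ := hη.pow 2
  have hχs : Function.support χ ⊆ closedBall x₀ R := fun x hx => hs fun h => hx (by simp [hχdef, h])
  have hχc : HasCompactSupport χ := hc.mono fun x hx h => hx (by simp [hχdef, h])
  -- the test function
  set w : Space N → ℂ := fun x => m * ((χ x : ℂ) * w₀ x) with hw
  set gw : Space N → EuclideanSpace ℂ (Fin N) :=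
    fun x => m • ((χ x : ℂ) • g₀ x + w₀ x • realGrad χ x) with hgw
  have hw2 : MemLp w 2 volume := (memLp_cutoff_mul hu2 hχ hχc).const_mul m
  have hgw2 : MemLp gw 2 volume := (memLp_cutoff_grad hu2 hg2 hχ hχc).const_smul m
  have hw1 : Integrable w volume := (integrable_cutoff_mul hu1 hχ hχc).const_mul m
  have hwm : StronglyMeasurable w :=
    ((Complex.continuous_ofReal.comp hχ.continuous).stronglyMeasurable.mul hum).const_mul m
  have hgwm : StronglyMeasurable gw := (stronglyMeasurable_cutoff_grad hum hgm hχ).const_smul m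
  have hwg : HasWeakGradient w gw := (hug.smul_smooth hu2 hg2 hχ hχc).const_mul m
  have hws : Function.support w ⊆ closedBall x₀ R := fun x hx =>
    hχs fun h => hx (by simp [hw, h])
  have hfun := funOf_toH1 hw2 hgw2 hwg
  have hgrad := gradOf_toH1 hw2 hgw2 hwg
  have key := heq (toH1 hw2 hgw2 hwg) (hw1.congr hfun.symm)
  rw [hF.apply_toH1 hwm hgwm hw2 hgw2 hwg hws hR] at key
  -- integrability
  have iA : Integrable (fun x => χ x * ‖g₀ x‖ ^ 2) volume :=
    integrable_cutoff_mul_real (hg2.integrable_norm_pow two_ne_zero) hχ.continuous hχc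
  have iL : Integrable (fun x => χ x * ‖w₀ x‖) volume :=
    integrable_cutoff_mul_real hu1.norm hχ.continuous hχc
  have iZ : Integrable (fun x => ‖realGrad η x‖ ^ 2 * ‖w₀ x‖ ^ 2) volume :=
    integrable_cutoff_mul_real (hu2.integrable_norm_pow two_ne_zero)
      ((continuous_realGrad hη).norm.pow 2)
      ((hasCompactSupport_realGrad hc).mono fun x hx h => hx (by simp [h]))
  -- the Dirichlet term
  have t1 : (∫ x, χ x * ‖g₀ x‖ ^ 2) / 2 - 2 * ‖m‖ ^ 2 * ∫ x, ‖realGrad η x‖ ^ 2 * ‖w₀ x‖ ^ 2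
      ≤ (∫ x, ∑ j, g₀ x j * conj (gradOf (toH1 hw2 hgw2 hwg) x j)).re := by
    have e : ∀ᵐ x, ∑ j, g₀ x j * conj (gradOf (toH1 hw2 hgw2 hwg) x j) = inner ℂ (gw x) (g₀ x) := by
      filter_upwards [hgrad] with x hx
      rw [hx, PiLp.inner_apply]
      simp only [RCLike.inner_apply]
    have i1 : Integrable (fun x => inner ℂ (gw x) (g₀ x)) volume := by
      refine (L2.integrable_inner (𝕜 := ℂ) (hgw2.toLp gw) (hg2.toLp g₀)).congr ?_
      filter_upwards [hgw2.coeFn_toLp, hg2.coeFn_toLp] with x h1 h2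
      rw [h1, h2]
    rw [integral_congr_ae e, ← Complex.reCLM_apply, ← Complex.reCLM.integral_comp_comm i1,
      ← integral_div, ← integral_const_mul, ← integral_sub (iA.div_const 2) (iZ.const_mul _)]
    refine integral_mono ((iA.div_const 2).sub (iZ.const_mul _)) (Complex.reCLM.integrable_comp i1)
      fun x => ?_
    simp only [hgw, hχdef, realGrad_sq hη, Complex.reCLM_apply]
    exact re_inner_cutoff_ge m (w₀ x) hmre (η x) (g₀ x) (realGrad η x)
  -- the zeroth order terms
  have t2 : (∫ x, a * U x * conj (funOf (toH1 hw2 hgw2 hwg) x)).re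
      = α * ∫ x, χ x * ‖w₀ x‖ := by
    -- Where `u = 0` both sides vanish whatever `U` is; elsewhere `U ū = |u|`.
    have e : ∀ᵐ x, a * U x * conj (funOf (toH1 hw2 hgw2 hwg) x)
        = a * conj m * ((χ x * ‖w₀ x‖ : ℝ) : ℂ) := by
      filter_upwards [hfun, hU.eq_sign] with x h1 h2
      rw [h1]
      by_cases h0 : w₀ x = 0
      · simp [hw, h0]
      · have h3 : ((‖w₀ x‖ : ℝ) : ℂ) ≠ 0 := by simpa using h0
        rw [h2 h0]
        simp only [hw, map_mul, Complex.conj_ofReal]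
        push_cast
        field_simp
        linear_combination (a * conj m * χ x) * (Complex.mul_conj' (w₀ x))
    rw [integral_congr_ae e, integral_const_mul, integral_complex_ofReal, Complex.re_mul_ofReal,
      hconj]
  have t3 : (∫ x, b * w₀ x * conj (funOf (toH1 hw2 hgw2 hwg) x)).re
      = (b.re + l * b.im) * ∫ x, χ x * ‖w₀ x‖ ^ 2 := by
    have e : ∀ᵐ x, b * w₀ x * conj (funOf (toH1 hw2 hgw2 hwg) x)
        = b * conj m * ((χ x * ‖w₀ x‖ ^ 2 : ℝ) : ℂ) := by
      filter_upwards [hfun] with x h1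
      rw [h1]
      simp only [hw, map_mul, Complex.conj_ofReal]
      push_cast
      linear_combination (b * conj m * χ x) * (Complex.mul_conj' (w₀ x))
    rw [integral_congr_ae e, integral_const_mul, integral_complex_ofReal, Complex.re_mul_ofReal,
      hconj]
  have t4 : 0 ≤ (∫ x, (φ x : ℂ) * w₀ x * conj (funOf (toH1 hw2 hgw2 hwg) x)).re := by
    have e : ∀ᵐ x, (φ x : ℂ) * w₀ x * conj (funOf (toH1 hw2 hgw2 hwg) x)
        = conj m * ((φ x * (χ x * ‖w₀ x‖ ^ 2) : ℝ) : ℂ) := by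
      filter_upwards [hfun] with x h1
      rw [h1]
      simp only [hw, map_mul, Complex.conj_ofReal]
      push_cast
      linear_combination (φ x * conj m * χ x) * (Complex.mul_conj' (w₀ x))
    rw [integral_congr_ae e, integral_const_mul, integral_complex_ofReal, Complex.re_mul_ofReal,
      Complex.conj_re, hmre, one_mul]
    refine integral_nonneg_of_ae ?_
    filter_upwards [hφ] with x hx
    have : 0 ≤ χ x := sq_nonneg _
    simp only [Pi.zero_apply]
    positivity
  -- the right-hand side
  have t5 : (∫ x in Kᶜ, f x * conj (w x)).re ≤ α / 2 * ∫ x, χ x * ‖w₀ x‖ := by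
    have hc0 : 0 ≤ α / (2 * ‖m‖) := by positivity
    have hfb : ∀ᵐ x ∂(volume.restrict Kᶜ), ‖f x‖ ≤ α / (2 * ‖m‖) := by
      filter_upwards [ae_le_eLpNormEssSup (f := f) (μ := volume.restrict Kᶜ)] with x hx
      rw [← eLpNorm_exponent_top] at hx
      have := hx.trans hf
      rwa [← ofReal_norm, ENNReal.ofReal_le_ofReal_iff hc0] at this
    refine (Complex.re_le_norm _).trans ?_
    refine (norm_integral_le_of_norm_le (g := fun x => α / 2 * (χ x * ‖w₀ x‖))
      (iL.const_mul _).integrableOn ?_).trans ?_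
    · filter_upwards [hfb] with x hx
      have h0 : 0 ≤ χ x := sq_nonneg _
      calc ‖f x * conj (w x)‖ = ‖f x‖ * (‖m‖ * (χ x * ‖w₀ x‖)) := by
            rw [norm_mul, Complex.norm_conj, hw, norm_mul, norm_mul, Complex.norm_real,
              Real.norm_of_nonneg h0]
        _ ≤ α / (2 * ‖m‖) * (‖m‖ * (χ x * ‖w₀ x‖)) := by gcongr
        _ = α / 2 * (χ x * ‖w₀ x‖) := by field_simp
    · rw [← integral_const_mul]
      refine setIntegral_le_integral (iL.const_mul _) (.of_forall fun x => ?_)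
      have h0 : 0 ≤ χ x := sq_nonneg _
      simp only [Pi.zero_apply]
      positivity
  rw [t2, t3] at key
  simp only [hχdef] at t1 t5 key t4
  linarith

/-! ### Decay of the energy on shrinking balls -/

/-- A De Giorgi type iteration: superlinear decay forces small energies to vanish. -/
theorem exists_threshold_of_recursion (N : ℕ) {C : ℝ} (hC : 0 < C) :
    ∃ δ : ℝ, 0 < δ ∧ ∀ E : ℝ → ℝ, (∀ s, 0 ≤ E s) → Monotone E →
      (∀ s t r : ℝ, 1 ≤ s → s < t → t ≤ 2 → 0 < r →
        E s ≤ C / (t - s) ^ 4 * (r ^ 2 * E t + E t ^ 2 / r ^ N)) →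
      E 2 ≤ δ → E 1 = 0 := by
  -- This ratio makes `q ^ k` cancel both the `16 ^ k` from `(t - s)⁻⁴` and the `4 ^ (N k)` from
  -- `r⁻ᴺ` in the quadratic term.
  set q : ℝ := (16 * 4 ^ N)⁻¹ with hq
  have hq0 : 0 < q := by positivity
  have hq1 : q < 1 := by
    rw [hq]
    refine inv_lt_one_of_one_lt₀ ?_
    have : (1 : ℝ) ≤ 4 ^ N := one_le_pow₀ (by norm_num)
    linarith
  set ε : ℝ := Real.sqrt (q / (32 * C)) with hε
  have hε0 : 0 < ε := by positivity
  have hε2 : ε ^ 2 = q / (32 * C) := Real.sq_sqrt (by positivity)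
  -- With these `ε` and `δ`, the linear and quadratic terms each contribute `q / 2` times the
  -- previous energy.
  set δ : ℝ := q * ε ^ N / (32 * C) with hδ
  have hδ0 : 0 < δ := by positivity
  refine ⟨δ, hδ0, fun E h0 hmono hrec h2 => ?_⟩
  have hk : ∀ k : ℕ, E (1 + (1 / 2) ^ k) ≤ δ * q ^ k := by
    intro k
    induction k with
    | zero => norm_num; exact h2
    | succ k ih =>
      have hp : (0 : ℝ) < (1 / 2) ^ k := by positivity
      have hp1 : (1 / 2 : ℝ) ^ k ≤ 1 := pow_le_one₀ (by norm_num) (by norm_num)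
      -- The radii decrease to 1 with gaps `2^{-(k+1)}`; taking `r = ε 4^{-k}` makes `r²` offset the
      -- blow-up of `(t - s)⁻⁴`.
      have hr := hrec (1 + (1 / 2) ^ (k + 1)) (1 + (1 / 2) ^ k) (ε * (1 / 4) ^ k)
        (by rw [pow_succ]; linarith) (by rw [pow_succ]; linarith) (by linarith) (by positivity)
      set e := E (1 + (1 / 2) ^ k) with he
      have he0 : 0 ≤ e := h0 _
      have hd : (1 + (1 / 2 : ℝ) ^ k - (1 + (1 / 2) ^ (k + 1))) ^ 4 = ((1 / 16) ^ k) / 16 := by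
        rw [pow_succ]
        have : (1 / 16 : ℝ) ^ k = ((1 / 2) ^ k) ^ 4 := by
          rw [← pow_mul, mul_comm, pow_mul]; norm_num
        rw [this]; ring
      rw [hd] at hr
      have hr2 : (ε * (1 / 4 : ℝ) ^ k) ^ 2 = ε ^ 2 * (1 / 16) ^ k := by
        rw [mul_pow, ← pow_mul, mul_comm k 2, pow_mul]; norm_num
      have hrN : (ε * (1 / 4 : ℝ) ^ k) ^ N = ε ^ N * ((1 / 4) ^ N) ^ k := by
        rw [mul_pow, ← pow_mul, ← pow_mul, mul_comm k N]
      rw [hr2, hrN] at hr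
      have hqk : q ^ k = (1 / 16) ^ k * ((1 / 4) ^ N) ^ k := by
        rw [hq, ← mul_pow]; congr 1; rw [mul_inv]; simp
      have hA : (0 : ℝ) < (1 / 16) ^ k := by positivity
      have hB : (0 : ℝ) < ((1 / 4) ^ N) ^ k := by positivity
      have hee : e ^ 2 ≤ e * (δ * q ^ k) := by rw [sq]; gcongr
      calc E (1 + (1 / 2) ^ (k + 1))
          ≤ C / ((1 / 16) ^ k / 16) *
            (ε ^ 2 * (1 / 16) ^ k * e + e ^ 2 / (ε ^ N * ((1 / 4) ^ N) ^ k)) := hr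
        _ ≤ C / ((1 / 16) ^ k / 16) *
            (ε ^ 2 * (1 / 16) ^ k * e + e * (δ * q ^ k) / (ε ^ N * ((1 / 4) ^ N) ^ k)) := by gcongr
        _ = q * e := by
            rw [hqk, hε2, hδ]
            have hG : 0 < ε ^ N := by positivity
            generalize (1 / 16 : ℝ) ^ k = A at hA ⊢
            generalize ((1 / 4 : ℝ) ^ N) ^ k = B at hB ⊢
            generalize ε ^ N = G at hG ⊢
            field_simp
            ring
        _ ≤ q * (δ * q ^ k) := by gcongr
        _ = δ * q ^ (k + 1) := by ring
  have hlim : Tendsto (fun k : ℕ => δ * q ^ k) atTop (𝓝 0) := by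
    simpa using (tendsto_pow_atTop_nhds_zero_of_lt_one hq0.le hq1).const_mul δ
  refine le_antisymm (ge_of_tendsto' hlim fun k => ?_) (h0 1)
  refine (hmono ?_).trans (hk k)
  have : (0 : ℝ) < (1 / 2) ^ k := by positivity
  linarith

/-- The energy density of a Sobolev function. -/
def energyDensity {N : ℕ} (u : H1 N) (x : Space N) : ℝ :=
  ‖gradOf u x‖ ^ 2 + ‖funOf u x‖ + ‖funOf u x‖ ^ 2

theorem energyDensity_nonneg {N : ℕ} (u : H1 N) (x : Space N) : 0 ≤ energyDensity u x := by
  unfold energyDensity; positivity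

theorem memLp_funOf {N : ℕ} (u : H1 N) : MemLp (funOf u) 2 volume := Lp.memLp _

theorem memLp_gradOf {N : ℕ} (u : H1 N) : MemLp (gradOf u) 2 volume := Lp.memLp _

theorem integrable_energyDensity {N : ℕ} {u : H1 N} (hu : Integrable (funOf u) volume) :
    Integrable (energyDensity u) volume :=
  (((memLp_gradOf u).integrable_norm_pow two_ne_zero).add hu.norm).add
    ((memLp_funOf u).integrable_norm_pow two_ne_zero)

/-- The energy in a closed ball. -/
def ballEnergy {N : ℕ} (u : H1 N) (x₀ : Space N) (s : ℝ) : ℝ :=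
  ∫ x in closedBall x₀ s, energyDensity u x

theorem ballEnergy_nonneg {N : ℕ} (u : H1 N) (x₀ : Space N) (s : ℝ) : 0 ≤ ballEnergy u x₀ s :=
  integral_nonneg fun _ => energyDensity_nonneg _ _

theorem ballEnergy_mono {N : ℕ} {u : H1 N} (hu : Integrable (funOf u) volume) (x₀ : Space N) :
    Monotone (ballEnergy u x₀) := fun _ _ h =>
  setIntegral_mono_set (integrable_energyDensity hu).integrableOn
    (.of_forall fun _ => energyDensity_nonneg _ _)
    (closedBall_subset_closedBall h).eventuallyLE

theorem realGrad_eq_zero_of_notMem {N : ℕ} {η : Space N → ℝ} {x₀ : Space N} {t : ℝ}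
    (hs : Function.support η ⊆ closedBall x₀ t) {x : Space N} (hx : x ∉ closedBall x₀ t) :
    realGrad η x = 0 := by
  have h : x ∉ tsupport η := fun h => hx (closure_minimal hs isClosed_closedBall h)
  have h2 : fderiv ℝ η x = 0 :=
    Function.notMem_support.1 fun h' => h (support_fderiv_subset ℝ h')
  exact norm_eq_zero.1 (le_antisymm ((norm_realGrad_le η x).trans (by simp [h2])) (norm_nonneg _))

/-- Superlinear control of the mass in a ball by the energy in a larger one. -/
theorem exists_mass_le (N : ℕ) : ∃ C : ℝ, 0 < C ∧ ∀ (u : H1 N), Integrable (funOf u) volume →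
    ∀ (x₀ : Space N) (s t r : ℝ), 1 ≤ s → s < t → t ≤ 2 → 0 < r →
    ∫ x in closedBall x₀ s, ‖funOf u x‖ ^ 2 ≤
      C / (t - s) ^ 2 * (r ^ 2 * ballEnergy u x₀ t + ballEnergy u x₀ t ^ 2 / r ^ N) := by
  obtain ⟨D, hD, hcut⟩ := exists_cutoff
  set c := volume.real (ball (0 : Space N) 1) with hc
  have hc0 : 0 < c := ENNReal.toReal_pos (measure_ball_pos _ _ one_pos).ne' measure_ball_lt_top.ne
  refine ⟨max (2 + 2 * D ^ 2) (2 / c), by positivity, fun u hu x₀ s t r hs hst ht hr => ?_⟩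
  obtain ⟨η, hη, h0, h1, hηs, hηt, hηg⟩ := hcut N x₀ s t hs hst ht
  have hηc : HasCompactSupport η :=
    (isCompact_closedBall x₀ t).of_isClosed_subset (isClosed_tsupport _)
      (closure_minimal hηt isClosed_closedBall)
  have hd : 0 < t - s := by linarith
  -- This lets the quadratic term, which carries no gradient of the cutoff, share the prefactor `(t
  -- - s)⁻²`.
  have hd1 : (t - s) ^ 2 ≤ 1 := by nlinarith
  have hum : StronglyMeasurable (funOf u) := Lp.stronglyMeasurable _
  have hgm : StronglyMeasurable (gradOf u) := Lp.stronglyMeasurable _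
  have hu2 := memLp_funOf u
  have hg2 := memLp_gradOf u
  have hwg : HasWeakGradient _ _ := HasWeakGradient.smul_smooth (u := funOf u) (g := gradOf u) u.2
    hu2 hg2 hη hηc
  have iE := integrable_energyDensity hu
  have hw2 := memLp_cutoff_mul hu2 hη hηc
  have hgw2 := memLp_cutoff_grad hu2 hg2 hη hηc
  have hw1 := integrable_cutoff_mul hu hη hηc
  have nash := integral_sq_le (w := fun x => (η x : ℂ) * funOf u x)
    ((Complex.continuous_ofReal.comp hη.continuous).stronglyMeasurable.mul hum)
    (stronglyMeasurable_cutoff_grad hum hgm hη) hw2 hgw2 hw1 hwg (x₀ := x₀) (R := t)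
    (fun x hx => hηt fun h => hx (by simp [h])) hr
  set E := ballEnergy u x₀ t with hE
  have hE0 : 0 ≤ E := ballEnergy_nonneg _ _ _
  have hind : E = ∫ x, (closedBall x₀ t).indicator (energyDensity u) x :=
    (integral_indicator measurableSet_closedBall).symm
  have iEi : Integrable ((closedBall x₀ t).indicator (energyDensity u)) volume :=
    iE.indicator measurableSet_closedBall
  -- The density contains `|u|` to the first power; this is the source of the superlinear `E²`.
  have b1 : ∫ x, ‖(η x : ℂ) * funOf u x‖ ≤ E := by
    rw [hind]
    refine integral_mono hw1.norm iEi fun x => ?_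
    by_cases hx : x ∈ closedBall x₀ t
    · simp only [indicator_of_mem hx, norm_mul, Complex.norm_real, Real.norm_of_nonneg (h0 x),
        energyDensity]
      have := mul_le_of_le_one_left (norm_nonneg (funOf u x)) (h1 x)
      have h3 : 0 ≤ ‖gradOf u x‖ ^ 2 := by positivity
      have h4 : 0 ≤ ‖funOf u x‖ ^ 2 := by positivity
      linarith
    · have : η x = 0 := Function.notMem_support.1 fun h => hx (hηt h)
      simp [indicator_of_notMem hx, this]
  have b2 : ∫ x, ‖(η x : ℂ) • gradOf u x + funOf u x • realGrad η x‖ ^ 2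
      ≤ (2 + 2 * D ^ 2) / (t - s) ^ 2 * E := by
    rw [hind, ← integral_const_mul]
    refine integral_mono (hgw2.integrable_norm_pow two_ne_zero) (iEi.const_mul _) fun x => ?_
    by_cases hx : x ∈ closedBall x₀ t
    · simp only [indicator_of_mem hx]
      have n1 : ‖(η x : ℂ) • gradOf u x + funOf u x • realGrad η x‖
          ≤ ‖gradOf u x‖ + D / (t - s) * ‖funOf u x‖ := by
        refine (norm_add_le _ _).trans (add_le_add ?_ ?_)
        · rw [norm_smul, Complex.norm_real, Real.norm_of_nonneg (h0 x)]
          exact mul_le_of_le_one_left (norm_nonneg _) (h1 x)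
        · rw [norm_smul, mul_comm]
          gcongr
          exact hηg x
      have n2 : ‖(η x : ℂ) • gradOf u x + funOf u x • realGrad η x‖ ^ 2
          ≤ 2 * ‖gradOf u x‖ ^ 2 + 2 * (D / (t - s)) ^ 2 * ‖funOf u x‖ ^ 2 := by
        refine (pow_le_pow_left₀ (norm_nonneg _) n1 2).trans ?_
        nlinarith [sq_nonneg (‖gradOf u x‖ - D / (t - s) * ‖funOf u x‖)]
      refine n2.trans ?_
      have k1 : 2 ≤ (2 + 2 * D ^ 2) / (t - s) ^ 2 := by
        rw [le_div_iff₀ (by positivity)]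
        nlinarith [sq_nonneg D]
      have k2 : 2 * (D / (t - s)) ^ 2 ≤ (2 + 2 * D ^ 2) / (t - s) ^ 2 := by
        rw [div_pow, mul_div_assoc']
        gcongr
        linarith
      have h3 : 0 ≤ ‖gradOf u x‖ ^ 2 := by positivity
      have h4 : 0 ≤ ‖funOf u x‖ ^ 2 := by positivity
      have h5 : 0 ≤ (2 + 2 * D ^ 2) / (t - s) ^ 2 * ‖funOf u x‖ := by positivity
      rw [energyDensity, mul_add, mul_add]
      nlinarith [mul_le_mul_of_nonneg_right k1 h3, mul_le_mul_of_nonneg_right k2 h4]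
    · have : η x = 0 := Function.notMem_support.1 fun h => hx (hηt h)
      simp [indicator_of_notMem hx, this, realGrad_eq_zero_of_notMem hηt hx]
  have b3 : ∫ x in closedBall x₀ s, ‖funOf u x‖ ^ 2 ≤ ∫ x, ‖(η x : ℂ) * funOf u x‖ ^ 2 := by
    rw [← integral_indicator measurableSet_closedBall]
    refine integral_mono ((hu2.integrable_norm_pow two_ne_zero).indicator
      measurableSet_closedBall) (hw2.integrable_norm_pow two_ne_zero) fun x => ?_
    by_cases hx : x ∈ closedBall x₀ s
    · simp [indicator_of_mem hx, hηs x hx]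
    · simp only [indicator_of_notMem hx]; positivity
  have b1' : 0 ≤ ∫ x, ‖(η x : ℂ) * funOf u x‖ := integral_nonneg fun _ => norm_nonneg _
  calc _ ≤ r ^ 2 * ((2 + 2 * D ^ 2) / (t - s) ^ 2 * E) + 2 / (c * r ^ N) * E ^ 2 := by
        refine b3.trans (nash.trans ?_)
        gcongr
    _ ≤ r ^ 2 * (max (2 + 2 * D ^ 2) (2 / c) / (t - s) ^ 2 * E)
        + max (2 + 2 * D ^ 2) (2 / c) / (t - s) ^ 2 * (E ^ 2 / r ^ N) := by
        refine add_le_add (by gcongr; exact le_max_left _ _) ?_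
        have : 2 / (c * r ^ N) * E ^ 2 = 2 / c * (E ^ 2 / r ^ N) := by field_simp
        rw [this]
        refine mul_le_mul_of_nonneg_right ?_ (by positivity)
        rw [le_div_iff₀ (by positivity)]
        refine le_trans ?_ (le_max_right (2 + 2 * D ^ 2) (2 / c))
        exact mul_le_of_le_one_right (by positivity) hd1
    _ = _ := by ring

/-- Small energies of solutions in balls away from `K` vanish on concentric smaller balls. -/
theorem exists_energy_threshold (N : ℕ) {a b : ℂ} {l : ℝ} (hα : 0 < a.re + l * a.im)
    (hβ : 0 < b.re + l * b.im) :
    ∃ δ : ℝ, 0 < δ ∧ ∀ (φ : Space N → ℝ) (F : HNegOne N) (u : H1 N) (U : Space N → ℂ)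
      (K : Set (Space N)) (f : Space N → ℂ) (x₀ : Space N), (∀ᵐ x, 0 ≤ φ x) →
      IsGlobalWeakSolution a b φ F u U → RestrictsTo F Kᶜ f →
      eLpNorm f ⊤ (volume.restrict Kᶜ) ≤
        ENNReal.ofReal ((a.re + l * a.im) / (2 * ‖1 + l * Complex.I‖)) →
      closedBall x₀ 3 ⊆ Kᶜ → ballEnergy u x₀ 2 ≤ δ → ballEnergy u x₀ 1 = 0 := by
  obtain ⟨D, hD, hcut⟩ := exists_cutoff
  obtain ⟨C, hC, hmass⟩ := exists_mass_le N
  set m : ℂ := 1 + l * Complex.I with hm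
  have hm0 : 0 < ‖m‖ := norm_pos_iff.2 fun h => by
    have : m.re = 1 := by simp [hm]
    simp [h] at this
  set κ : ℝ := min (1 / 2) (min ((a.re + l * a.im) / 2) (b.re + l * b.im)) with hκ
  have hκ0 : 0 < κ := by positivity
  -- The factor 32 is the 2 of the energy estimate times a 4 from each of two squared half-gaps `(t
  -- - s) / 2`.
  set C' : ℝ := 32 * ‖m‖ ^ 2 * D ^ 2 * C / κ with hC'
  obtain ⟨δ, hδ, hrec⟩ := exists_threshold_of_recursion N (C := C') (by positivity)
  refine ⟨δ, hδ, fun φ F u U K f x₀ hφ hsol hF hf hK hE2 => ?_⟩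
  have hu := hsol.integrable
  have hu2 := memLp_funOf u
  have hg2 := memLp_gradOf u
  have iE := integrable_energyDensity hu
  refine hrec (ballEnergy u x₀) (ballEnergy_nonneg u x₀) (ballEnergy_mono hu x₀) ?_ hE2
  intro s t r hs hst ht hr
  -- The energy estimate is used between `s` and `p`, the mass bound between `p` and `t`.
  set p := (s + t) / 2 with hp
  have hsp : s < p := by rw [hp]; linarith
  have hpt : p < t := by rw [hp]; linarith
  obtain ⟨η, hη, h0, h1, hηs, hηt, hηg⟩ := hcut N x₀ s p hs hsp (by linarith)
  have hηc : HasCompactSupport η :=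
    (isCompact_closedBall x₀ p).of_isClosed_subset (isClosed_tsupport _)
      (closure_minimal hηt isClosed_closedBall)
  have hχc : HasCompactSupport fun x => η x ^ 2 := hηc.mono fun x hx h => hx (by simp [h])
  -- The outer radius is at most 2 and the mollification margin is 1, hence the ball of radius 3.
  have en := hsol.energy_le hφ hα hF hf (x₀ := x₀) (R := p)
    ((closedBall_subset_closedBall (by linarith)).trans hK) hη hηt
  have iA : Integrable (fun x => η x ^ 2 * ‖gradOf u x‖ ^ 2) volume :=
    integrable_cutoff_mul_real (hg2.integrable_norm_pow two_ne_zero) (hη.continuous.pow 2) hχc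
  have iL : Integrable (fun x => η x ^ 2 * ‖funOf u x‖) volume :=
    integrable_cutoff_mul_real hu.norm (hη.continuous.pow 2) hχc
  have iS : Integrable (fun x => η x ^ 2 * ‖funOf u x‖ ^ 2) volume :=
    integrable_cutoff_mul_real (hu2.integrable_norm_pow two_ne_zero) (hη.continuous.pow 2) hχc
  have iZ : Integrable (fun x => ‖realGrad η x‖ ^ 2 * ‖funOf u x‖ ^ 2) volume :=
    integrable_cutoff_mul_real (hu2.integrable_norm_pow two_ne_zero)
      ((continuous_realGrad hη).norm.pow 2)
      ((hasCompactSupport_realGrad hηc).mono fun x hx h => hx (by simp [h]))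
  set A := ∫ x, η x ^ 2 * ‖gradOf u x‖ ^ 2 with hA
  set L := ∫ x, η x ^ 2 * ‖funOf u x‖ with hL
  set S := ∫ x, η x ^ 2 * ‖funOf u x‖ ^ 2 with hS
  have hA0 : 0 ≤ A := integral_nonneg fun x => by positivity
  have hL0 : 0 ≤ L := integral_nonneg fun x => by positivity
  have hS0 : 0 ≤ S := integral_nonneg fun x => by positivity
  have e1 : ballEnergy u x₀ s ≤ A + L + S := by
    have iAL : Integrable (fun x => η x ^ 2 * ‖gradOf u x‖ ^ 2 + η x ^ 2 * ‖funOf u x‖) volume :=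
      iA.add iL
    rw [hA, hL, hS, ← integral_add iA iL, ← integral_add iAL iS, ballEnergy,
      ← integral_indicator measurableSet_closedBall]
    refine integral_mono (iE.indicator measurableSet_closedBall) (iAL.add iS) fun x => ?_
    by_cases hx : x ∈ closedBall x₀ s
    · simp [indicator_of_mem hx, hηs x hx, energyDensity]
    · simp only [indicator_of_notMem hx]; positivity
  have e2 : ∫ x, ‖realGrad η x‖ ^ 2 * ‖funOf u x‖ ^ 2
      ≤ (D / (p - s)) ^ 2 * ∫ x in closedBall x₀ p, ‖funOf u x‖ ^ 2 := by
    rw [← integral_indicator measurableSet_closedBall, ← integral_const_mul]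
    refine integral_mono iZ (((hu2.integrable_norm_pow two_ne_zero).indicator
      measurableSet_closedBall).const_mul _) fun x => ?_
    by_cases hx : x ∈ closedBall x₀ p
    · simp only [indicator_of_mem hx]
      gcongr
      exact hηg x
    · simp [indicator_of_notMem hx, realGrad_eq_zero_of_notMem hηt hx]
  have e3 := hmass u hu x₀ p t r (by linarith) hpt ht hr
  set E := ballEnergy u x₀ t with hE
  have hκ1 : κ ≤ 1 / 2 := min_le_left _ _
  have hκ2 : κ ≤ (a.re + l * a.im) / 2 := (min_le_right _ _).trans (min_le_left _ _)
  have hκ3 : κ ≤ b.re + l * b.im := (min_le_right _ _).trans (min_le_right _ _)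
  have hd : 0 < t - s := by linarith
  have hps : p - s = (t - s) / 2 := by rw [hp]; ring
  have htp : t - p = (t - s) / 2 := by rw [hp]; ring
  rw [hps] at e2
  rw [htp] at e3
  have main : κ * ballEnergy u x₀ s ≤ 2 * ‖m‖ ^ 2 * ((D / ((t - s) / 2)) ^ 2 *
      (C / ((t - s) / 2) ^ 2 * (r ^ 2 * E + E ^ 2 / r ^ N))) := by
    calc κ * ballEnergy u x₀ s ≤ κ * (A + L + S) := by gcongr
      _ ≤ A / 2 + (a.re + l * a.im) / 2 * L + (b.re + l * b.im) * S := by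
          nlinarith [mul_le_mul_of_nonneg_right hκ1 hA0, mul_le_mul_of_nonneg_right hκ2 hL0,
            mul_le_mul_of_nonneg_right hκ3 hS0]
      _ ≤ _ := en
      _ ≤ _ := by
          gcongr
          exact e2.trans (by gcongr)
  rw [← le_div_iff₀' hκ0] at main
  refine main.trans (le_of_eq ?_)
  rw [hC']
  field_simp
  ring

/-- The energy of an integrable Sobolev function in far away balls is small. -/
theorem exists_ballEnergy_le {N : ℕ} {u : H1 N} (hu : Integrable (funOf u) volume) {δ : ℝ}
    (hδ : 0 < δ) : ∃ R : ℝ, ∀ x₀ : Space N, R < ‖x₀‖ → ballEnergy u x₀ 2 ≤ δ := by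
  have iE := integrable_energyDensity hu
  have ht := tendsto_setIntegral_of_antitone (μ := volume) (f := energyDensity u)
    (s := fun n : ℕ => (closedBall (0 : Space N) n)ᶜ)
    (fun n => measurableSet_closedBall.compl)
    (fun n m h => compl_subset_compl.2 (closedBall_subset_closedBall (by exact_mod_cast h)))
    ⟨0, iE.integrableOn⟩
  have hempty : ⋂ n : ℕ, (closedBall (0 : Space N) n)ᶜ = ∅ := by
    rw [← compl_iUnion, iUnion_closedBall_nat, compl_univ]
  rw [hempty, setIntegral_empty] at ht
  obtain ⟨n, hn⟩ := (ht.eventually_lt_const hδ).exists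
  refine ⟨n + 2, fun x₀ hx₀ => le_trans ?_ hn.le⟩
  refine setIntegral_mono_set iE.integrableOn (.of_forall fun _ => energyDensity_nonneg _ _)
    (LE.le.eventuallyLE fun x hx hx' => ?_)
  rw [mem_closedBall, dist_eq_norm] at hx hx'
  rw [sub_zero] at hx'
  have := norm_sub_norm_le x₀ x
  rw [norm_sub_rev] at this
  linarith

/-- The density is nonnegative and strictly positive wherever `u ≠ 0`. -/
theorem notMem_essSupp_of_ballEnergy_eq_zero {N : ℕ} {u : H1 N}
    (hu : Integrable (funOf u) volume) {x₀ : Space N} (h : ballEnergy u x₀ 1 = 0) :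
    x₀ ∉ essSupp (funOf u) := by
  rw [essSupp, Measure.notMem_support_iff_exists]
  refine ⟨closedBall x₀ 1, closedBall_mem_nhds _ one_pos, ?_⟩
  have h1 := (setIntegral_eq_zero_iff_of_nonneg_ae
    (.of_forall fun _ => energyDensity_nonneg _ _)
    (integrable_energyDensity hu).integrableOn).1 h
  rw [Measure.restrict_apply measurableSet_closedBall]
  rw [Filter.EventuallyEq, ae_restrict_iff' measurableSet_closedBall, ae_iff] at h1
  refine measure_mono_null (fun x hx => ?_) h1
  simp only [mem_ofPred_eq, Classical.not_imp, Pi.zero_apply]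
  refine ⟨hx.1, ?_⟩
  have : 0 < ‖funOf u x‖ := norm_pos_iff.2 hx.2
  unfold energyDensity
  positivity

end SaturatedSchrodinger

end

/-! ### Choice of `M` and compactness of the support -/

theorem theorem5p1 :
    ∃ M : ℂ × ℂ → ℝ,
      ContinuousOn M {p : ℂ × ℂ | SaturatedSchrodinger.Admissible p.1 p.2} ∧
      (∀ a b : ℂ, SaturatedSchrodinger.Admissible a b → 0 < M (a, b)) ∧
      ∀ (N : ℕ), 1 ≤ N →
      ∀ (a b : ℂ), SaturatedSchrodinger.Admissible a b →
      ∀ (φ : SaturatedSchrodinger.Space N → ℝ), SaturatedSchrodinger.IsPotential φ →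
      ∀ (F : SaturatedSchrodinger.HNegOne N) (u : SaturatedSchrodinger.H1 N)
        (U : SaturatedSchrodinger.Space N → ℂ),
        SaturatedSchrodinger.IsGlobalWeakSolution a b φ F u U →
      ∀ (K : Set (SaturatedSchrodinger.Space N)), IsCompact K →
        (∃ f : SaturatedSchrodinger.Space N → ℂ, SaturatedSchrodinger.RestrictsTo F Kᶜ f ∧
          MeasureTheory.eLpNorm f ⊤ (MeasureTheory.volume.restrict Kᶜ)
            ≤ ENNReal.ofReal (1 / M (a, b))) →
        IsCompact (SaturatedSchrodinger.essSupp (SaturatedSchrodinger.funOf u)) := by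
  obtain ⟨l, hlc, hl⟩ := SaturatedSchrodinger.exists_continuousOn_multiplier
  have hm0 : ∀ t : ℝ, 0 < ‖1 + (t : ℂ) * Complex.I‖ := fun t => norm_pos_iff.2 fun h => by
    simpa using congrArg Complex.re h
  -- The reciprocal is the bound on `f` in the energy estimate. The threshold `δ` may depend on `N`,
  -- but `M` involves only the multiplier and `a`.
  refine ⟨fun p => 2 * ‖1 + (l p : ℂ) * Complex.I‖ / (p.1.re + l p * p.1.im), ?_, ?_, ?_⟩
  · refine ContinuousOn.div ?_ ?_ fun p hp => (hl p hp).1.ne'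
    · exact (continuous_const.mul (Continuous.norm (f := fun t : ℝ => 1 + (t : ℂ) * Complex.I)
        (by fun_prop))).comp_continuousOn hlc
    · exact (Complex.continuous_re.comp continuous_fst).continuousOn.add
        (hlc.mul (Complex.continuous_im.comp continuous_fst).continuousOn)
  · intro a b h
    exact div_pos (mul_pos two_pos (hm0 _)) (hl (a, b) h).1
  · rintro N - a b hab φ hφ F u U hsol K hK ⟨f, hF, hf⟩
    obtain ⟨hα, hβ⟩ := hl (a, b) hab
    obtain ⟨δ, hδ, H⟩ := SaturatedSchrodinger.exists_energy_threshold N hα hβ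
    obtain ⟨R, hR⟩ := SaturatedSchrodinger.exists_ballEnergy_le hsol.integrable hδ
    obtain ⟨R', hR'⟩ := hK.isBounded.subset_closedBall 0
    rw [one_div_div] at hf
    -- Beyond `R` the energy is below the threshold; beyond `R' + 3` the ball of radius 3 misses
    -- `K`.
    refine (isCompact_closedBall (0 : SaturatedSchrodinger.Space N)
      (max R (R' + 3))).of_isClosed_subset Measure.isClosed_support fun x₀ hx₀ => ?_
    by_contra hx
    rw [Metric.mem_closedBall, dist_zero_right, not_le, max_lt_iff] at hx
    refine SaturatedSchrodinger.notMem_essSupp_of_ballEnergy_eq_zero hsol.integrable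
      (H φ F u U K f x₀ hφ.1 hsol hF hf (fun y hy hyK => ?_) (hR x₀ hx.1)) hx₀
    have h1 := hR' hyK
    rw [Metric.mem_closedBall, dist_eq_norm] at h1 hy
    rw [sub_zero] at h1
    have := norm_sub_norm_le x₀ y
    rw [norm_sub_rev] at this
    linarith [hx.2]
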